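/- Let $m\in\mathbb N$ and consider a system $\mathbf y=\mathbf G(x,\mathbf y)$ of $m$ equations $y_i=G_i(x,y_1,\dots,y_m)$, where the $G_i$ are formal power series with real coefficients. All derivatives of power series are formal, $J_{\mathbf G}=(\partial G_i/\partial y_j)_{i,j}$, and a series with nonnegative coefficients is evaluated at points with nonnegative coordinates as a sum in $[0,\infty]$. The system is called *well-conditioned* if (1) all $G_i$ have nonnegative coefficients; (2) $\mathbf G$ is holomorphic in a neighborhood of the origin; (3) $\mathbf G(0,\mathbf y)=\mathbf 0$; (4) $G_i(x,\mathbf 0)\neq 0$ for all $i$; (5) $\det(I-J_{\mathbf G}(0,\mathbf 0))\ne 0$; (6) the system is irreducible, i.e. the directed graph on $\{1,\dots,m\}$ with an edge $i\to j$ whenever $\partial G_i/\partial y_j\neq 0$ is strongly connected; (7) $\partial^2 G_i/\partial y_j\partial y_k\ne 0$ for some $i,j,k$. A *standard solution* is a vector $\mathbf T(x)$ of formal power series with nonnegative coefficients and zero constant terms such that formally $\mathbf T(x)=\mathbf G(x,\mathbf T(x))$. The *extreme point* is the point $(\rho,\boldsymbol\tau)\in\mathbb R^{m+1}$ such that $\rho$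 is the common radius of convergence of the components $T_i$ of the standard solution and $\tau_i=T_i(\rho)<\infty$. The *positive domain* is $\mathsf{Dom}^+(\mathbf G)=\{(a,\mathbf b)\in\mathbb R^{m+1}: a,b_1,\dots,b_m>0,\ G_i(a,\mathbf b)<\infty \text{ for all } i\}$; interior and boundary are taken in $\mathbb R^{m+1}$. At a point $(a,\mathbf b)$ with positive coordinates at which all entries of $J_{\mathbf G}$ converge, $\Lambda(a,\mathbf b)$ denotes the largest real eigenvalue of $J_{\mathbf G}(a,\mathbf b)$. A *characteristic point* is a point $(a,\mathbf b)\in\mathbb R^{m+1}$ with positive coordinates such that $\mathbf b=\mathbf G(a,\mathbf b)$, all entries of $J_{\mathbf G}(a,\mathbf b)$ are finite, and $\det(I-J_{\mathbf G}(a,\mathbf b))=0$. An *eigenpoint* is a characteristic point $(a,\mathbf b)$ with $\Lambda(a,\mathbf b)=1$. **Theorem.** Let $\mathbf y=\mathbf G(x,\mathbf y)$ be a well-conditioned system. Then the extreme point $(\rho,\boldsymbol\tau)$ exists and is unique, and the following hold. (a) $(\rho,\boldsymbol\tau)\in\mathsf{Dom}^+(\mathbf G)$. (b) If $(\rho,\boldsymbol\tau)$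 is in the interior of $\mathsf{Dom}^+(\mathbf G)$, then it is an eigenpoint. (c) The system has at most one eigenpoint. (d) If there is an eigenpoint, then it must be $(\rho,\boldsymbol\tau)$. (e) If there is no eigenpoint, then $(\rho,\boldsymbol\tau)$ lies on the boundary of $\mathsf{Dom}^+(\mathbf G)$, all entries of $J_{\mathbf G}(\rho,\boldsymbol\tau)$ are finite, and $\Lambda(\rho,\boldsymbol\tau)<1$. -/

import Mathlib

open Filter Topology

noncomputable section

namespace RecursiveSystem

/-- The value in `[0, ∞]` of a power series with nonnegative coefficients in `k` variables at a
point of `ℝ ^ k` with nonnegative coordinates. -/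
def evalNN {k : ℕ} (A : MvPowerSeries (Fin k) ℝ) (c : Fin k → ℝ) : ENNReal :=
  ∑' d : Fin k →₀ ℕ, ENNReal.ofReal (MvPowerSeries.coeff d A * ∏ i, c i ^ d i)

/-- The power series `A` converges in a neighbourhood of the origin of `ℂ ^ k`, and its sum is
holomorphic there. -/
def IsHolomorphicNearZero {k : ℕ} (A : MvPowerSeries (Fin k) ℝ) : Prop :=
  ∃ f : (Fin k → ℂ) → ℂ, AnalyticAt ℂ f 0 ∧
    ∀ᶠ z in 𝓝 (0 : Fin k → ℂ),
      HasSum (fun d : Fin k →₀ ℕ => ((MvPowerSeries.coeff d A : ℝ) : ℂ) * ∏ i, z i ^ d i) (f z)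

variable {m : ℕ}

/-
A system `y = G(x, y)` of `m` equations is given by the `m` power series `G i` in `m + 1`
variables: the variable with index `0` is `x`, the variable with index `j.succ` is `y_j`.
Correspondingly a point `(a, b)` of `ℝ ^ (m + 1)` is a function `p : Fin (m + 1) → ℝ`
with `p 0 = a` and `p j.succ = b_j`.
-/

/-- The formal partial derivative `∂ G_i / ∂ y_j`. -/
def partialY (G : Fin m → MvPowerSeries (Fin (m + 1)) ℝ) (i j : Fin m) :
    MvPowerSeries (Fin (m + 1)) ℝ :=
  MvPowerSeries.pderiv ℝ j.succ (G i)

/-- All entries of the Jacobian matrix `(∂ G_i / ∂ y_j)` converge at `p`. -/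
def JacobianFinite (G : Fin m → MvPowerSeries (Fin (m + 1)) ℝ) (p : Fin (m + 1) → ℝ) : Prop :=
  ∀ i j, evalNN (partialY G i j) p < ⊤

/-- The value at `p` of the Jacobian matrix `(∂ G_i / ∂ y_j)`, as a real matrix; it is used only
at points where all entries are finite. -/
def jacobian (G : Fin m → MvPowerSeries (Fin (m + 1)) ℝ) (p : Fin (m + 1) → ℝ) :
    Matrix (Fin m) (Fin m) ℝ :=
  Matrix.of fun i j => (evalNN (partialY G i j) p).toReal

/-- Well-conditioned systems `y = G(x, y)`. -/
structure IsWellConditioned (G : Fin m → MvPowerSeries (Fin (m + 1)) ℝ) : Prop where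
  /-- the coefficients are nonnegative -/
  nonneg : ∀ i d, 0 ≤ MvPowerSeries.coeff d (G i)
  /-- `G` is holomorphic in a neighbourhood of the origin -/
  holomorphic : ∀ i, IsHolomorphicNearZero (G i)
  /-- `G(0, y) = 0`: no monomial free of `x` occurs -/
  zero_left : ∀ i (d : Fin (m + 1) →₀ ℕ), d 0 = 0 → MvPowerSeries.coeff d (G i) = 0
  /-- `G_i(x, 0) ≠ 0`: some monomial free of all `y_j` occurs -/
  zero_right : ∀ i, ∃ n : ℕ, MvPowerSeries.coeff (Finsupp.single 0 n) (G i) ≠ 0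
  /-- `det (I - J_G(0, 0)) ≠ 0` -/
  det_ne_zero : (1 - jacobian G 0).det ≠ 0
  /-- the matrix `J_G` of power series is irreducible: the directed graph with an edge from `i`
  to `j` whenever `∂ G_i / ∂ y_j ≠ 0` is strongly connected -/
  irreducible : ∀ i j : Fin m, Relation.ReflTransGen (fun k l => partialY G k l ≠ 0) i j
  /-- some second partial derivative with respect to the `y` variables is not zero -/
  nonlinear : ∃ i j k : Fin m, MvPowerSeries.pderiv ℝ k.succ (partialY G i j) ≠ 0

/-- `T` is a standard solution: the `T_i` are power series in `x` with nonnegative coefficients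
and zero constant term, and formally `T(x) = G(x, T(x))`. -/
structure IsStandardSolution (G : Fin m → MvPowerSeries (Fin (m + 1)) ℝ)
    (T : Fin m → PowerSeries ℝ) : Prop where
  nonneg : ∀ i n, 0 ≤ PowerSeries.coeff n (T i)
  constantCoeff_eq_zero : ∀ i, PowerSeries.constantCoeff (T i) = 0
  eq_subst : ∀ i, T i =
    MvPowerSeries.subst (Fin.cons PowerSeries.X T : Fin (m + 1) → PowerSeries ℝ) (G i)

/-- The radius of convergence, in `[0, ∞]`, of a power series in one variable. -/
def radius (A : PowerSeries ℝ) : ENNReal :=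
  (FormalMultilinearSeries.ofScalars ℝ (fun n => PowerSeries.coeff n A)).radius

/-- `p = (ρ, τ)` is the extreme point of the system: `ρ` is the common radius of convergence of
the components `T_i` of the standard solution, and `T_i(ρ)` converges to `τ_i`. -/
def IsExtremePoint (G : Fin m → MvPowerSeries (Fin (m + 1)) ℝ) (p : Fin (m + 1) → ℝ) : Prop :=
  ∃ T : Fin m → PowerSeries ℝ, IsStandardSolution G T ∧ 0 ≤ p 0 ∧
    ∀ i, radius (T i) = ENNReal.ofReal (p 0) ∧
      HasSum (fun n => PowerSeries.coeff n (T i) * p 0 ^ n) (p i.succ)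

/-- The positive domain of `G`. -/
def posDomain (G : Fin m → MvPowerSeries (Fin (m + 1)) ℝ) : Set (Fin (m + 1) → ℝ) :=
  {p | (∀ k, 0 < p k) ∧ ∀ i, evalNN (G i) p < ⊤}

/-- Characteristic points: the positive solutions `(a, b)` of the equations `y = G(x, y)` and
`det (I - J_G(x, y)) = 0`, with all series involved convergent. -/
structure IsCharacteristicPoint (G : Fin m → MvPowerSeries (Fin (m + 1)) ℝ)
    (p : Fin (m + 1) → ℝ) : Prop where
  pos : ∀ k, 0 < p k
  solution : ∀ i, evalNN (G i) p = ENNReal.ofReal (p i.succ)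
  jacobianFinite : JacobianFinite G p
  det_eq_zero : (1 - jacobian G p).det = 0

/-- `l = Λ(p)`: the Jacobian matrix is finite at `p` and `l` is its largest real eigenvalue. -/
def IsLambda (G : Fin m → MvPowerSeries (Fin (m + 1)) ℝ) (p : Fin (m + 1) → ℝ) (l : ℝ) : Prop :=
  JacobianFinite G p ∧
    IsGreatest {r : ℝ | Module.End.HasEigenvalue (Matrix.toLin' (jacobian G p)) r} l

/-- Eigenpoints: characteristic points `p` with `Λ(p) = 1`. -/
def IsEigenpoint (G : Fin m → MvPowerSeries (Fin (m + 1)) ℝ) (p : Fin (m + 1) → ℝ) : Prop :=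
  IsCharacteristicPoint G p ∧ IsLambda G p 1

end RecursiveSystem

end

/-!
The standard solution `T` is the least nonnegative solution of the system. Irreducibility spreads
finiteness of `T_i(x)` to all components, so these have a common radius of convergence, and for `x`
bounded away from `0` the nonlinear term gives `T_i(x)² ≤ C T_i(x)` for some `i`. Hence `T_i` is
bounded where it is finite, and `ρ` and `T(ρ)` are finite. By convexity the increment
`w = T(y) - T(x)` satisfies `J(x, T(x)) w < w` for `x < y ≤ ρ`, which makes `J(ρ, τ)` finite with
Perron root at most one. A Perron root below one in the interior of the domain would yield a
supersolution with first coordinate beyond `ρ`.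

At an eigenpoint `(a, b)` one has `T(a) ≤ b`. Pairing with the positive left Perron vector, the
second-order term of `G` forces equality. The positive right Perron vector is then fixed by
`J(a, T(a))`, which rules out finite increments beyond `a`, so that `a = ρ`.
-/

noncomputable section

open scoped Matrix

namespace RecursiveSystem

section PerronFrobenius

theorem isIrreducible_of_reflTransGen {n : Type*} [Finite n] {A : Matrix n n ℝ}
    (hA : ∀ i j, 0 ≤ A i j) (hedge : ∃ k l, A k l ≠ 0)
    (hpath : ∀ i j, Relation.ReflTransGen (fun k l => A k l ≠ 0) i j) : A.IsIrreducible := by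
  classical
  cases nonempty_fintype n
  have hpos {k l : n} (h : A k l ≠ 0) : 0 < A k l := (hA k l).lt_of_ne' h
  refine (Matrix.isIrreducible_iff_exists_pow_pos hA).2 fun i j => ?_
  obtain ⟨k, l, hkl⟩ := hedge
  have htrans : Relation.TransGen (fun k l => A k l ≠ 0) i j :=
    (Relation.TransGen.tail' (hpath i k) hkl).trans_left (hpath l j)
  induction htrans with
  | single h => exact ⟨1, one_pos, by rw [pow_one]; exact hpos h⟩
  | @tail b c _ h ih =>
    obtain ⟨N, -, hN⟩ := ih
    refine ⟨N + 1, N.succ_pos, ?_⟩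
    rw [pow_succ, Matrix.mul_apply]
    exact (mul_pos hN (hpos h)).trans_le (Finset.single_le_sum (f := fun l => (A ^ N) i l * A l c)
      (fun l _ => mul_nonneg (Matrix.pow_apply_nonneg hA N i l) (hA l c)) (Finset.mem_univ b))

variable {n : Type*} [Fintype n] {A : Matrix n n ℝ}

theorem mulVec_pos {P : Matrix n n ℝ} (hP : ∀ i j, 0 < P i j) {z : n → ℝ} (hz : 0 ≤ z)
    (hz' : z ≠ 0) (i : n) : 0 < (P *ᵥ z) i := by
  obtain ⟨j, hj⟩ := Function.ne_iff.1 hz'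
  exact Finset.sum_pos' (fun l _ => mul_nonneg (hP i l).le (hz l))
    ⟨j, Finset.mem_univ _, mul_pos (hP i j) ((hz j).lt_of_ne' hj)⟩

theorem exists_commute_pos (hA : A.IsIrreducible) :
    ∃ P : Matrix n n ℝ, Commute P A ∧ ∀ i j, 0 < P i j := by
  classical
  choose k _ hk using (Matrix.isIrreducible_iff_exists_pow_pos hA.nonneg).1 hA
  refine ⟨∑ ij : n × n, A ^ k ij.1 ij.2, ?_, fun i j => ?_⟩
  · exact Commute.sum_left _ _ _ fun ij _ => (Commute.refl A).pow_left _
  · rw [Matrix.sum_apply]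
    exact Finset.sum_pos' (fun ij _ => Matrix.pow_apply_nonneg hA.nonneg _ i j)
      ⟨(i, j), Finset.mem_univ _, hk i j⟩

/-- The values taken by the Collatz–Wielandt function of a nonnegative matrix, and all smaller
nonnegative numbers. The maximum of this set is the Perron root. -/
def collatzWielandt (A : Matrix n n ℝ) : Set ℝ :=
  {r | 0 ≤ r ∧ ∃ u ∈ stdSimplex ℝ n, r • u ≤ A *ᵥ u}

theorem mem_collatzWielandt {r : ℝ} (hr : 0 ≤ r) {w : n → ℝ} (hw : 0 ≤ w) (hw' : w ≠ 0)
    (h : r • w ≤ A *ᵥ w) : r ∈ collatzWielandt A := by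
  have hsum : 0 < ∑ i, w i := by
    obtain ⟨j, hj⟩ := Function.ne_iff.1 hw'
    exact Finset.sum_pos' (fun i _ => hw i) ⟨j, Finset.mem_univ _, (hw j).lt_of_ne' hj⟩
  refine ⟨hr, (∑ i, w i)⁻¹ • w, ⟨fun i => mul_nonneg (inv_nonneg.2 hsum.le) (hw i), ?_⟩, ?_⟩
  · simp only [Pi.smul_apply, smul_eq_mul, ← Finset.mul_sum, inv_mul_cancel₀ hsum.ne']
  · rw [Matrix.mulVec_smul, smul_comm]
    exact smul_le_smul_of_nonneg_left h (inv_nonneg.2 hsum.le)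

theorem isCompact_collatzWielandt (hA : ∀ i j, 0 ≤ A i j) : IsCompact (collatzWielandt A) := by
  set R : ℝ := ∑ i, ∑ j, A i j
  have le_R {r : ℝ} {u : n → ℝ} (hu : u ∈ stdSimplex ℝ n) (h : r • u ≤ A *ᵥ u) : r ≤ R :=
    calc r = ∑ i, r * u i := by rw [← Finset.mul_sum, hu.2, mul_one]
      _ ≤ ∑ i, ∑ j, A i j * u j := Finset.sum_le_sum fun i _ => h i
      _ ≤ R := Finset.sum_le_sum fun i _ => Finset.sum_le_sum fun j _ =>
        mul_le_of_le_one_right (hA i j)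
          (hu.2 ▸ Finset.single_le_sum (fun l _ => hu.1 l) (Finset.mem_univ j))
  have hK : IsCompact ((Set.Icc 0 R ×ˢ stdSimplex ℝ n) ∩
      {x : ℝ × (n → ℝ) | x.1 • x.2 ≤ A *ᵥ x.2}) :=
    (isCompact_Icc.prod (isCompact_stdSimplex ℝ n)).inter_right
      (isClosed_le (by fun_prop) (by fun_prop))
  convert hK.image continuous_fst
  ext r
  constructor
  · rintro ⟨hr, u, hu, h⟩
    exact ⟨(r, u), ⟨⟨⟨hr, le_R hu h⟩, hu⟩, h⟩, rfl⟩
  · rintro ⟨⟨r, u⟩, ⟨⟨hr, hu⟩, h⟩, rfl⟩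
    exact ⟨hr.1, u, hu, h⟩

theorem exists_lt_smul_le_mulVec {r : ℝ} {w : n → ℝ} (h : ∀ i, r * w i < (A *ᵥ w) i) :
    ∃ s > r, s • w ≤ A *ᵥ w := by
  have near : ∀ᶠ s in 𝓝[>] r, ∀ i, s * w i < (A *ᵥ w) i :=
    eventually_all.2 fun i =>
      ((by fun_prop : Continuous fun s : ℝ => s * w i).tendsto r).eventually_lt_const (h i)
        |>.filter_mono nhdsWithin_le_nhds
  obtain ⟨s, hs, hrs⟩ := (near.and self_mem_nhdsWithin).exists
  exact ⟨s, hrs, fun i => (hs i).le⟩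

theorem exists_pos_eigenvector [Nonempty n] (hA : A.IsIrreducible) :
    ∃ (r : ℝ) (v : n → ℝ), (∀ i, 0 < v i) ∧ A *ᵥ v = r • v := by
  obtain ⟨P, hPA, hP⟩ := exists_commute_pos hA
  have nonempty : (collatzWielandt A).Nonempty := by
    refine ⟨0, mem_collatzWielandt le_rfl zero_le_one one_ne_zero ?_⟩
    rw [zero_smul]
    exact fun i => dotProduct_nonneg_of_nonneg (hA.nonneg i) zero_le_one
  obtain ⟨r, ⟨hr, u, hu, hru⟩, hmax⟩ :=
    (isCompact_collatzWielandt hA.nonneg).exists_isGreatest nonempty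
  have hu0 : u ≠ 0 := by
    rintro rfl
    simpa using hu.2
  have hPu : ∀ i, 0 < (P *ᵥ u) i := mulVec_pos hP hu.1 hu0
  have hcomm : A *ᵥ P *ᵥ u - r • P *ᵥ u = P *ᵥ (A *ᵥ u - r • u) := by
    rw [Matrix.mulVec_sub, Matrix.mulVec_mulVec, Matrix.mulVec_mulVec, hPA.eq, Matrix.mulVec_smul]
  have huA : A *ᵥ u - r • u = 0 := by
    by_contra hne
    have hlt : ∀ i, r * (P *ᵥ u) i < (A *ᵥ P *ᵥ u) i := fun i =>
      sub_pos.1 (by simpa [← hcomm] using mulVec_pos hP (sub_nonneg.2 hru) hne i)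
    obtain ⟨s, hrs, hs⟩ := exists_lt_smul_le_mulVec hlt
    obtain ⟨i⟩ := ‹Nonempty n›
    exact hrs.not_ge <| hmax <| mem_collatzWielandt (hr.trans hrs.le) (fun i => (hPu i).le)
      (fun h => (hPu i).ne' (congrFun h i)) hs
  exact ⟨r, P *ᵥ u, hPu, sub_eq_zero.1 (by rw [hcomm, huA, Matrix.mulVec_zero])⟩

theorem eigenvalue_le_of_pos_left_eigenvector [DecidableEq n] (hA : ∀ i j, 0 ≤ A i j) {r : ℝ}
    {u : n → ℝ} (hu : ∀ i, 0 < u i) (hAu : u ᵥ* A = r • u) {s : ℝ}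
    (hs : Module.End.HasEigenvalue (Matrix.toLin' A) s) : s ≤ r := by
  obtain ⟨z, hz⟩ := hs.exists_hasEigenvector
  have hAz : A *ᵥ z = s • z := by simpa using hz.apply_eq_smul
  have hpos : 0 < u ⬝ᵥ |z| := by
    obtain ⟨j, hj⟩ := Function.ne_iff.1 hz.2
    exact Finset.sum_pos' (fun i _ => mul_nonneg (hu i).le (abs_nonneg _))
      ⟨j, Finset.mem_univ _, mul_pos (hu j) (abs_pos.2 hj)⟩
  have hle : s • |z| ≤ A *ᵥ |z| := fun i =>
    calc s * |z i| ≤ |s| * |z i| := mul_le_mul_of_nonneg_right (le_abs_self s) (abs_nonneg _)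
      _ = |(A *ᵥ z) i| := by rw [hAz, Pi.smul_apply, smul_eq_mul, abs_mul]
      _ ≤ ∑ j, |A i j * z j| := Finset.abs_sum_le_sum_abs _ _
      _ = (A *ᵥ |z|) i :=
        Finset.sum_congr rfl fun j _ => by rw [abs_mul, abs_of_nonneg (hA i j), Pi.abs_apply]
  refine le_of_mul_le_mul_right ?_ hpos
  calc s * (u ⬝ᵥ |z|) = u ⬝ᵥ s • |z| := by rw [dotProduct_smul, smul_eq_mul]
    _ ≤ u ⬝ᵥ A *ᵥ |z| := dotProduct_le_dotProduct_of_nonneg_left hle fun i => (hu i).le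
    _ = r * (u ⬝ᵥ |z|) := by rw [Matrix.dotProduct_mulVec, hAu, smul_dotProduct, smul_eq_mul]

theorem exists_perron_root [Nonempty n] [DecidableEq n] (hA : A.IsIrreducible) :
    ∃ (r : ℝ) (v u : n → ℝ), (∀ i, 0 < v i) ∧ (∀ i, 0 < u i) ∧ A *ᵥ v = r • v ∧
      u ᵥ* A = r • u ∧ IsGreatest {s | Module.End.HasEigenvalue (Matrix.toLin' A) s} r := by
  obtain ⟨r, v, hv, hAv⟩ := exists_pos_eigenvector hA
  obtain ⟨r', u, hu, hAu⟩ := exists_pos_eigenvector hA.transpose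
  rw [Matrix.mulVec_transpose] at hAu
  have hr : Module.End.HasEigenvalue (Matrix.toLin' A) r := by
    refine Module.End.hasEigenvalue_of_hasEigenvector (x := v) ⟨?_, ?_⟩
    · rw [Module.End.mem_eigenspace_iff, Matrix.toLin'_apply, hAv]
    · rintro rfl
      exact (hv (Classical.arbitrary n)).ne' rfl
  have hrr' : r = r' := by
    have huv : 0 < u ⬝ᵥ v :=
      Finset.sum_pos (fun i _ => mul_pos (hu i) (hv i)) Finset.univ_nonempty
    refine mul_right_cancel₀ huv.ne' ?_
    calc r * (u ⬝ᵥ v) = u ⬝ᵥ A *ᵥ v := by rw [hAv, dotProduct_smul, smul_eq_mul]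
      _ = r' * (u ⬝ᵥ v) := by rw [Matrix.dotProduct_mulVec, hAu, smul_dotProduct, smul_eq_mul]
  subst hrr'
  exact ⟨r, v, u, hv, hu, hAv, hAu, hr, fun s hs =>
    eigenvalue_le_of_pos_left_eigenvector hA.nonneg hu hAu hs⟩

end PerronFrobenius

section PolynomialTaylor

open MvPolynomial

variable {σ R : Type*} [Fintype σ] [CommSemiring R]

theorem sum_mul_eval_pderiv_mul_X (P : MvPolynomial σ R) (j : σ) (c h : σ → R) :
    ∑ k, h k * eval c (pderiv k (P * X j)) =
      c j * ∑ k, h k * eval c (pderiv k P) + h j * eval c P := by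
  classical
  simp only [Derivation.leibniz, pderiv_X, Pi.single_apply, smul_eq_mul, map_add, map_mul, eval_X,
    mul_add, Finset.sum_add_distrib, Finset.mul_sum]
  rw [add_comm]
  congr 1
  · exact Finset.sum_congr rfl fun k _ => mul_left_comm _ _ _
  · rw [Finset.sum_eq_single j (fun k _ hk => by simp [hk.symm]) (by simp)]
    simp

theorem exists_eval_add_smul_eq (P : MvPolynomial σ R) (p h : σ → R) :
    ∃ Q : Polynomial R, ∀ t, eval (p + t • h) P =
      eval p P + t * ∑ k, h k * eval p (pderiv k P) + t ^ 2 * Q.eval t := by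
  induction P using MvPolynomial.induction_on with
  | C a => exact ⟨0, fun t => by simp⟩
  | add P₁ P₂ ih₁ ih₂ =>
    obtain ⟨Q₁, hQ₁⟩ := ih₁
    obtain ⟨Q₂, hQ₂⟩ := ih₂
    refine ⟨Q₁ + Q₂, fun t => ?_⟩
    simp only [map_add, hQ₁, hQ₂, mul_add, Finset.sum_add_distrib, Polynomial.eval_add]
    ring
  | mul_X P j ih =>
    obtain ⟨Q, hQ⟩ := ih
    refine ⟨.C (h j * ∑ k, h k * eval p (pderiv k P)) + Q * (.C (p j) + .C (h j) * .X),
      fun t => ?_⟩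
    simp only [sum_mul_eval_pderiv_mul_X, map_mul, eval_X, hQ, Pi.add_apply, Pi.smul_apply,
      smul_eq_mul, Polynomial.eval_add, Polynomial.eval_mul, Polynomial.eval_C, Polynomial.eval_X]
    ring

theorem eval_add_le [PartialOrder R] [IsOrderedRing R] [CanonicallyOrderedAdd R]
    (P : MvPolynomial σ R) (p h : σ → R) :
    eval (p + h) P ≤ eval p P + ∑ k, h k * eval (p + h) (pderiv k P) := by
  induction P using MvPolynomial.induction_on with
  | C a => simp
  | add P₁ P₂ ih₁ ih₂ =>
    simp only [map_add, mul_add, Finset.sum_add_distrib]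
    exact (add_le_add ih₁ ih₂).trans_eq (add_add_add_comm _ _ _ _)
  | mul_X P j ih =>
    rw [sum_mul_eval_pderiv_mul_X, map_mul, map_mul, eval_X, eval_X, Pi.add_apply]
    set D := ∑ k, h k * eval (p + h) (pderiv k P)
    calc eval (p + h) P * (p j + h j)
        = eval (p + h) P * p j + h j * eval (p + h) P := by ring
      _ ≤ (eval p P + D) * p j + h j * eval (p + h) P := by gcongr
      _ = eval p P * p j + (p j * D + h j * eval (p + h) P) := by ring
      _ ≤ eval p P * p j + ((p j + h j) * D + h j * eval (p + h) P) := by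
        gcongr
        exact le_self_add

end PolynomialTaylor

section Evaluation

variable {σ : Type*}

/-- The value in `[0, ∞]` of a power series at a point with coordinates in `[0, ∞]`. Negative
coefficients are replaced by `0`, so this is meant for series with nonnegative coefficients. -/
def ev (A : MvPowerSeries σ ℝ) (c : σ → ENNReal) : ENNReal :=
  ∑' d : σ →₀ ℕ, ENNReal.ofReal (MvPowerSeries.coeff d A) * d.prod fun i e => c i ^ e

/-- The semiring of power series with nonnegative coefficients. -/
def nonnegCoeff (σ : Type*) : Subsemiring (MvPowerSeries σ ℝ) where
  carrier := {A | ∀ d, 0 ≤ MvPowerSeries.coeff d A}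
  zero_mem' _ := le_rfl
  one_mem' d := by
    classical
    rw [MvPowerSeries.coeff_one]
    split_ifs <;> norm_num
  add_mem' hA hB d := add_nonneg (hA d) (hB d)
  mul_mem' hA hB d := by
    classical
    rw [MvPowerSeries.coeff_mul]
    exact Finset.sum_nonneg fun p _ => mul_nonneg (hA _) (hB _)

variable {A B : MvPowerSeries σ ℝ}

theorem X_mem_nonnegCoeff (i : σ) : MvPowerSeries.X i ∈ nonnegCoeff σ := fun d => by
  classical
  rw [MvPowerSeries.coeff_X]
  split_ifs <;> norm_num

theorem pderiv_mem_nonnegCoeff (hA : A ∈ nonnegCoeff σ) (j : σ) :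
    MvPowerSeries.pderiv ℝ j A ∈ nonnegCoeff σ := fun d => by
  rw [MvPowerSeries.coeff_pderiv]
  exact mul_nonneg (hA _) (by positivity)

theorem ev_mono (A : MvPowerSeries σ ℝ) : Monotone (ev A) := fun _ _ h =>
  ENNReal.tsum_le_tsum fun _ =>
    mul_le_mul_right (Finset.prod_le_prod' fun i _ => pow_le_pow_left' (h i) _) _

theorem ev_ne_zero_of_coeff_pos {d : σ →₀ ℕ} (hd : 0 < MvPowerSeries.coeff d A)
    {c : σ → ENNReal} (hc : ∀ i ∈ d.support, c i ≠ 0) : ev A c ≠ 0 := fun h =>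
  mul_ne_zero (ENNReal.ofReal_pos.2 hd).ne'
    (Finset.prod_ne_zero_iff.2 fun i hi => pow_ne_zero _ (hc i hi)) (ENNReal.tsum_eq_zero.1 h d)

theorem ev_ne_zero (hA : A ∈ nonnegCoeff σ) (hA0 : A ≠ 0) {c : σ → ENNReal} (hc : ∀ i, c i ≠ 0) :
    ev A c ≠ 0 :=
  have ⟨d, hd⟩ := (MvPowerSeries.ne_zero_iff_exists_coeff_ne_zero A).1 hA0
  ev_ne_zero_of_coeff_pos ((hA d).lt_of_ne' hd) fun i _ => hc i

theorem ev_zero (c : σ → ENNReal) : ev 0 c = 0 := by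
  simp [ev]

theorem ev_one (c : σ → ENNReal) : ev 1 c = 1 := by
  classical
  rw [ev, tsum_eq_single 0 fun d hd => by simp [MvPowerSeries.coeff_one, hd]]
  simp

theorem ev_X (i : σ) (c : σ → ENNReal) : ev (MvPowerSeries.X i) c = c i := by
  classical
  rw [ev, tsum_eq_single (Finsupp.single i 1) fun d hd => by simp [MvPowerSeries.coeff_X, hd]]
  simp

theorem ev_add (hA : A ∈ nonnegCoeff σ) (hB : B ∈ nonnegCoeff σ) (c : σ → ENNReal) :
    ev (A + B) c = ev A c + ev B c := by
  simp only [ev, map_add, ENNReal.ofReal_add (hA _) (hB _), add_mul, ENNReal.tsum_add]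

theorem ev_mul (hA : A ∈ nonnegCoeff σ) (hB : B ∈ nonnegCoeff σ) (c : σ → ENNReal) :
    ev (A * B) c = ev A c * ev B c := by
  classical
  rw [ev, ev, ev, ← ENNReal.tsum_mul_right]
  simp only [← ENNReal.tsum_mul_left]
  rw [← ENNReal.tsum_prod (f := fun d e => ENNReal.ofReal (MvPowerSeries.coeff d A) *
      (d.prod fun i k => c i ^ k) * (ENNReal.ofReal (MvPowerSeries.coeff e B) *
      e.prod fun i k => c i ^ k)),
    ← Finset.HasAntidiagonal.sigmaAntidiagonalEquivProd.tsum_eq, ENNReal.tsum_sigma']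
  refine tsum_congr fun n => ?_
  rw [MvPowerSeries.coeff_mul, ENNReal.ofReal_sum_of_nonneg fun p _ => mul_nonneg (hA _) (hB _),
    tsum_fintype, Finset.sum_mul, ← Finset.sum_coe_sort]
  refine Finset.sum_congr rfl fun ⟨⟨d, e⟩, hde⟩ _ => ?_
  obtain rfl := Finset.HasAntidiagonal.mem_antidiagonal.1 hde
  rw [ENNReal.ofReal_mul (hA _), Finsupp.prod_add_index' (fun _ => pow_zero _) fun _ => pow_add _,
    Finset.HasAntidiagonal.sigmaAntidiagonalEquivProd_apply]
  exact mul_mul_mul_comm _ _ _ _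

/-- Evaluation at a point as a semiring homomorphism. It is defined on series with nonnegative
coefficients because `ev`, truncating the others at `0`, is not multiplicative beyond these. -/
def evHom (c : σ → ENNReal) : nonnegCoeff σ →+* ENNReal where
  toFun A := ev A c
  map_zero' := ev_zero c
  map_one' := ev_one c
  map_add' A B := ev_add A.2 B.2 c
  map_mul' A B := ev_mul A.2 B.2 c

theorem ev_prod_pow {ι : Type*} {a : ι → MvPowerSeries σ ℝ} (ha : ∀ i, a i ∈ nonnegCoeff σ)
    (d : ι →₀ ℕ) (c : σ → ENNReal) :
    ev (d.prod fun i e => a i ^ e) c = d.prod fun i e => ev (a i) c ^ e := by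
  let a' (i : ι) : nonnegCoeff σ := ⟨a i, ha i⟩
  calc ev (d.prod fun i e => a i ^ e) c = evHom c (d.prod fun i e => a' i ^ e) :=
        congrArg (ev · c) (by simp [a', Finsupp.prod])
    _ = d.prod fun i e => evHom c (a' i) ^ e := by simp only [map_finsuppProd, map_pow]

theorem ev_pderiv (A : MvPowerSeries σ ℝ) (j : σ) (c : σ → ENNReal) :
    ev (MvPowerSeries.pderiv ℝ j A) c = ∑' d : σ →₀ ℕ, ENNReal.ofReal (MvPowerSeries.coeff d A) *
      MvPolynomial.eval c (MvPolynomial.pderiv j (MvPolynomial.monomial d 1)) := by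
  have hinj : Function.Injective fun d : σ →₀ ℕ => d + Finsupp.single j 1 := add_left_injective _
  rw [← hinj.tsum_eq]
  · refine tsum_congr fun d => ?_
    rw [MvPowerSeries.coeff_pderiv, ENNReal.ofReal_mul' (by positivity), mul_assoc,
      MvPolynomial.pderiv_monomial, MvPolynomial.eval_monomial, add_tsub_cancel_right, one_mul,
      Finsupp.add_apply, Finsupp.single_eq_same]
    norm_cast
  · intro d hd
    refine ⟨d - Finsupp.single j 1, tsub_add_cancel_of_le (Finsupp.single_le_iff.2 ?_)⟩
    by_contra hlt
    have hdj : d j = 0 := by omega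
    simp [MvPolynomial.pderiv_monomial, hdj] at hd

theorem ev_eq_tsum_eval_monomial (A : MvPowerSeries σ ℝ) (c : σ → ENNReal) :
    ev A c = ∑' d, ENNReal.ofReal (MvPowerSeries.coeff d A) *
      MvPolynomial.eval c (MvPolynomial.monomial d 1) := by
  simp only [MvPolynomial.eval_monomial, one_mul, ev]

theorem ev_le_mul_ev_of_X_dvd {s : σ} (hA : MvPowerSeries.X s ∣ A) {p q : σ → ENNReal}
    (hpq : p ≤ q) {t : ENNReal} (ht : t ≤ 1) (hs : p s ≤ t * q s) : ev A p ≤ t * ev A q := by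
  classical
  rw [ev, ev, ← ENNReal.tsum_mul_left]
  refine ENNReal.tsum_le_tsum fun d => ?_
  obtain hd | hd := eq_or_ne (d s) 0
  · simp [MvPowerSeries.X_dvd_iff.1 hA d hd]
  · have hprod (c : σ → ENNReal) : (d.prod fun i e => c i ^ e) =
        c s ^ d s * (d.erase s).prod fun i e => c i ^ e :=
      (Finsupp.mul_prod_erase d s _ (Finsupp.mem_support_iff.2 hd)).symm
    rw [mul_left_comm, hprod p, hprod q, ← mul_assoc t]
    refine mul_le_mul_right (mul_le_mul' ?_ ?_) _
    · calc p s ^ d s ≤ (t * q s) ^ d s := pow_le_pow_left' hs _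
        _ = t ^ d s * q s ^ d s := mul_pow _ _ _
        _ ≤ t * q s ^ d s := by
          gcongr
          exact pow_le_of_le_one zero_le ht hd
    · exact Finset.prod_le_prod' fun i _ => pow_le_pow_left' (hpq i) _

theorem sum_mul_ev_pderiv [Fintype σ] (A : MvPowerSeries σ ℝ) (p h : σ → ENNReal) :
    ∑ j, h j * ev (MvPowerSeries.pderiv ℝ j A) p =
      ∑' d, ENNReal.ofReal (MvPowerSeries.coeff d A) *
        ∑ j, h j * MvPolynomial.eval p (MvPolynomial.pderiv j (MvPolynomial.monomial d 1)) := by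
  simp only [ev_pderiv, ← ENNReal.tsum_mul_left]
  rw [← Summable.tsum_finsetSum fun _ _ => ENNReal.summable]
  simp only [Finset.mul_sum, mul_left_comm]

theorem ev_add_sum_pderiv_le [Fintype σ] (A : MvPowerSeries σ ℝ) (p h : σ → ENNReal) :
    ev A p + ∑ j, h j * ev (MvPowerSeries.pderiv ℝ j A) p ≤ ev A (p + h) := by
  rw [sum_mul_ev_pderiv]
  simp only [ev_eq_tsum_eval_monomial, ← ENNReal.tsum_add, ← mul_add]
  refine ENNReal.tsum_le_tsum fun d => mul_le_mul_right ?_ _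
  obtain ⟨Q, hQ⟩ := exists_eval_add_smul_eq (MvPolynomial.monomial d 1) p h
  simpa using (hQ 1).ge.trans' le_self_add

theorem ev_add_smul_le [Fintype σ] (A : MvPowerSeries σ ℝ) (p h : σ → ENNReal) {t : ENNReal}
    (ht : t ≤ 1) :
    ev A (p + t • h) ≤
      ev A p + t * ∑ j, h j * ev (MvPowerSeries.pderiv ℝ j A) p + t ^ 2 * ev A (p + h) := by
  rw [sum_mul_ev_pderiv]
  simp only [ev_eq_tsum_eval_monomial, ← ENNReal.tsum_mul_left,
    ← ENNReal.tsum_add, mul_left_comm _ (ENNReal.ofReal _), ← mul_add]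
  refine ENNReal.tsum_le_tsum fun d => mul_le_mul_right ?_ _
  obtain ⟨Q, hQ⟩ := exists_eval_add_smul_eq (MvPolynomial.monomial d 1) p h
  have hQt : Q.eval t ≤ Q.eval 1 := by
    simp only [Polynomial.eval_eq_sum, Polynomial.sum]
    gcongr
  have hQ1 : Q.eval 1 ≤ MvPolynomial.eval (p + h) (MvPolynomial.monomial d 1) := by
    simpa using (hQ 1).ge.trans' le_add_self
  rw [hQ]
  gcongr
  exact hQt.trans hQ1

theorem ev_add_le [Fintype σ] (A : MvPowerSeries σ ℝ) (p h : σ → ENNReal) :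
    ev A (p + h) ≤ ev A p + ∑ j, h j * ev (MvPowerSeries.pderiv ℝ j A) (p + h) := by
  rw [sum_mul_ev_pderiv]
  simp only [ev_eq_tsum_eval_monomial, ← ENNReal.tsum_add, ← mul_add]
  exact ENNReal.tsum_le_tsum fun d => mul_le_mul_right (eval_add_le _ p h) _

theorem mul_ev_pderiv_le [Finite σ] (A : MvPowerSeries σ ℝ) (p h : σ → ENNReal) (j : σ) :
    h j * ev (MvPowerSeries.pderiv ℝ j A) p ≤ ev A (p + h) := by
  cases nonempty_fintype σ
  exact (Finset.single_le_sum_of_canonicallyOrdered (Finset.mem_univ j)).trans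
    (le_add_self.trans (ev_add_sum_pderiv_le A p h))

theorem mul_mul_ev_pderiv_pderiv_le [Finite σ] (A : MvPowerSeries σ ℝ) (p h : σ → ENNReal)
    (j k : σ) :
    h j * (h k * ev (MvPowerSeries.pderiv ℝ k (MvPowerSeries.pderiv ℝ j A)) p) ≤
      ev A (p + h + h) :=
  (mul_le_mul_right (mul_ev_pderiv_le _ p h k) _).trans (mul_ev_pderiv_le A (p + h) h j)

theorem evalNN_eq_ev {k : ℕ} (A : MvPowerSeries (Fin k) ℝ) {c : Fin k → ℝ} (hc : 0 ≤ c) :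
    evalNN A c = ev A (ENNReal.ofReal ∘ c) := by
  refine tsum_congr fun d => ?_
  rw [ENNReal.ofReal_mul' (Finset.prod_nonneg fun i _ => pow_nonneg (hc i) _),
    ENNReal.ofReal_prod_of_nonneg fun i _ => pow_nonneg (hc i) _,
    Finsupp.prod_fintype _ _ fun i => pow_zero _]
  simp only [ENNReal.ofReal_pow (hc _), Function.comp_apply]

end Evaluation

section Substitution

variable {σ τ : Type*} {A : MvPowerSeries σ ℝ} {a : σ → MvPowerSeries τ ℝ}

theorem subst_mem_nonnegCoeff (hA : A ∈ nonnegCoeff σ) (ha : ∀ i, a i ∈ nonnegCoeff τ)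
    (hsub : MvPowerSeries.HasSubst a) : MvPowerSeries.subst a A ∈ nonnegCoeff τ := fun e => by
  rw [MvPowerSeries.coeff_subst hsub]
  exact finsum_nonneg fun d => mul_nonneg (hA d) (prod_mem (fun i _ => pow_mem (ha i) (d i)) e)

theorem ofReal_coeff_subst (hA : A ∈ nonnegCoeff σ) (ha : ∀ i, a i ∈ nonnegCoeff τ)
    (hsub : MvPowerSeries.HasSubst a) (e : τ →₀ ℕ) :
    ENNReal.ofReal (MvPowerSeries.coeff e (MvPowerSeries.subst a A)) =
      ∑' d : σ →₀ ℕ, ENNReal.ofReal (MvPowerSeries.coeff d A) *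
        ENNReal.ofReal (MvPowerSeries.coeff e (d.prod fun i k => a i ^ k)) := by
  have hnonneg (d : σ →₀ ℕ) : 0 ≤ MvPowerSeries.coeff e (d.prod fun i k => a i ^ k) :=
    prod_mem (fun i _ => pow_mem (ha i) (d i)) e
  have hfin := MvPowerSeries.coeff_subst_finite hsub A e
  simp only [smul_eq_mul] at hfin
  simp only [MvPowerSeries.coeff_subst hsub, smul_eq_mul]
  rw [← tsum_eq_finsum (L := .unconditional _) hfin,
    ENNReal.ofReal_tsum_of_nonneg (fun d => mul_nonneg (hA d) (hnonneg d))
      (summable_of_hasFiniteSupport hfin)]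
  exact tsum_congr fun d => ENNReal.ofReal_mul (hA d)

theorem ev_subst (hA : A ∈ nonnegCoeff σ) (ha : ∀ i, a i ∈ nonnegCoeff τ)
    (hsub : MvPowerSeries.HasSubst a) (x : τ → ENNReal) :
    ev (MvPowerSeries.subst a A) x = ev A fun i => ev (a i) x := by
  rw [ev]
  simp only [ofReal_coeff_subst hA ha hsub, ← ENNReal.tsum_mul_right]
  rw [ENNReal.tsum_comm]
  refine tsum_congr fun d => ?_
  rw [← ev_prod_pow ha, ev, ← ENNReal.tsum_mul_left]
  simp only [mul_assoc]

end Substitution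

section Univariate

/-- The value in `[0, ∞]` of a power series in one variable. -/
def ev₁ (S : PowerSeries ℝ) (x : ENNReal) : ENNReal :=
  ev S fun _ => x

variable {S : PowerSeries ℝ}

theorem ev₁_eq_tsum (S : PowerSeries ℝ) (x : ENNReal) :
    ev₁ S x = ∑' n, ENNReal.ofReal (PowerSeries.coeff n S) * x ^ n := by
  rw [ev₁, ev, ← (Finsupp.uniqueEquiv ()).symm.tsum_eq]
  refine tsum_congr fun n => ?_
  rw [PowerSeries.coeff, Finsupp.uniqueEquiv_symm_apply, Finsupp.prod_single_index]
  exact pow_zero x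

theorem ev₁_mono (S : PowerSeries ℝ) : Monotone (ev₁ S) := fun _ _ h =>
  ev_mono S fun _ => h

theorem tendsto_ev₁_nhdsLT (S : PowerSeries ℝ) (x : ENNReal) :
    Tendsto (ev₁ S) (𝓝[<] x) (𝓝 (ev₁ S x)) := by
  refine tendsto_order.2 ⟨fun b hb => ?_, fun b hb => ?_⟩
  · have lsc : LowerSemicontinuous (ev₁ S) := by
      rw [funext (ev₁_eq_tsum S)]
      exact lowerSemicontinuous_tsum fun n => ((ENNReal.continuous_const_mul
        ENNReal.ofReal_ne_top).comp (ENNReal.continuous_pow n)).lowerSemicontinuous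
    exact (lsc x b hb).filter_mono nhdsWithin_le_nhds
  · filter_upwards [self_mem_nhdsWithin] with y hy
    exact (ev₁_mono S (le_of_lt hy)).trans_lt hb

theorem mul_ev₁_le_ev₁_mul (hS : PowerSeries.constantCoeff S = 0) {c : ENNReal} (hc : 1 ≤ c)
    (x : ENNReal) : c * ev₁ S x ≤ ev₁ S (c * x) := by
  rw [ev₁_eq_tsum, ev₁_eq_tsum, ← ENNReal.tsum_mul_left]
  refine ENNReal.tsum_le_tsum fun n => ?_
  obtain rfl | hn := eq_or_ne n 0
  · simp [hS]
  · rw [mul_left_comm, mul_pow]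
    gcongr
    exact le_self_pow₀ hc hn

theorem ev₁_ofReal (S : PowerSeries ℝ) {x : ℝ} (hx : 0 ≤ x) :
    ev₁ S (ENNReal.ofReal x) = ∑' n, ENNReal.ofReal (PowerSeries.coeff n S * x ^ n) := by
  simp only [ev₁_eq_tsum, ENNReal.ofReal_mul' (pow_nonneg hx _), ENNReal.ofReal_pow hx]

theorem hasSum_iff_ev₁ (hS : S ∈ nonnegCoeff Unit) {x y : ℝ} (hx : 0 ≤ x) (hy : 0 ≤ y) :
    HasSum (fun n => PowerSeries.coeff n S * x ^ n) y ↔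
      ev₁ S (ENNReal.ofReal x) = ENNReal.ofReal y := by
  have hnonneg (n : ℕ) : 0 ≤ PowerSeries.coeff n S * x ^ n := mul_nonneg (hS _) (pow_nonneg hx n)
  rw [ev₁_ofReal S hx]
  constructor
  · intro h
    rw [← ENNReal.ofReal_tsum_of_nonneg hnonneg h.summable, h.tsum_eq]
  · intro h
    have hsum := ENNReal.summable_toReal (h ▸ ENNReal.ofReal_ne_top)
    simp only [ENNReal.toReal_ofReal (hnonneg _)] at hsum
    rw [← ENNReal.ofReal_tsum_of_nonneg hnonneg hsum,
      ENNReal.ofReal_eq_ofReal_iff (tsum_nonneg hnonneg) hy] at h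
    exact h ▸ hsum.hasSum

theorem summable_norm_ofScalars_iff (hS : S ∈ nonnegCoeff Unit) (x : NNReal) :
    (Summable fun n => ‖FormalMultilinearSeries.ofScalars ℝ (fun n => PowerSeries.coeff n S) n‖ *
      (x : ℝ) ^ n) ↔ ev₁ S x ≠ ⊤ := by
  have hnonneg (n : ℕ) : 0 ≤ PowerSeries.coeff n S * (x : ℝ) ^ n :=
    mul_nonneg (hS _) (pow_nonneg x.coe_nonneg n)
  have hnorm (n : ℕ) : ‖PowerSeries.coeff n S‖ = PowerSeries.coeff n S := Real.norm_of_nonneg (hS _)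
  simp only [FormalMultilinearSeries.ofScalars_norm, hnorm]
  rw [← ENNReal.ofReal_coe_nnreal, ev₁_ofReal S x.coe_nonneg]
  refine ⟨fun h => h.tsum_ofReal_ne_top, fun h => ?_⟩
  simpa only [ENNReal.toReal_ofReal (hnonneg _)] using ENNReal.summable_toReal h

theorem ev₁_ne_top_of_lt_radius (hS : S ∈ nonnegCoeff Unit) {x : ENNReal}
    (hx : x < radius S) : ev₁ S x ≠ ⊤ := by
  lift x to NNReal using hx.ne_top
  exact (summable_norm_ofScalars_iff hS x).1 (FormalMultilinearSeries.summable_norm_mul_pow _ hx)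

theorem le_radius_of_ev₁_ne_top (hS : S ∈ nonnegCoeff Unit) {x : ENNReal} (hx : x ≠ ⊤)
    (h : ev₁ S x ≠ ⊤) : x ≤ radius S := by
  lift x to NNReal using hx
  exact FormalMultilinearSeries.le_radius_of_summable _ ((summable_norm_ofScalars_iff hS x).2 h)

end Univariate

section FormalSolution

open PowerSeries (X)

theorem coeff_eq_of_X_pow_dvd_sub {R : Type*} [CommRing R] {S T : PowerSeries R} {N n : ℕ}
    (h : X ^ N ∣ S - T) (hn : n < N) : PowerSeries.coeff n S = PowerSeries.coeff n T :=
  sub_eq_zero.1 <| by rw [← map_sub, PowerSeries.X_pow_dvd_iff.1 h n hn]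

theorem X_pow_dvd_subst_sub {σ R : Type*} [CommRing R] {a b : σ → PowerSeries R}
    (ha : MvPowerSeries.HasSubst a) (hb : MvPowerSeries.HasSubst b) (A : MvPowerSeries σ R) {N : ℕ}
    (h : ∀ i, X ^ N ∣ a i - b i) :
    X ^ N ∣ (MvPowerSeries.subst a A - MvPowerSeries.subst b A : PowerSeries R) := by
  refine PowerSeries.X_pow_dvd_iff.2 fun n hn => ?_
  rw [map_sub, sub_eq_zero, PowerSeries.coeff, MvPowerSeries.coeff_subst ha,
    MvPowerSeries.coeff_subst hb]
  refine finsum_congr fun d => congrArg _ <| coeff_eq_of_X_pow_dvd_sub ?_ hn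
  simp only [← Ideal.mem_span_singleton, ← Ideal.Quotient.eq] at h ⊢
  simp only [Finsupp.prod, map_prod, map_pow, h]

theorem exists_forall_X_pow_dvd_sub {R : Type*} [CommRing R] {S : ℕ → PowerSeries R}
    (h : ∀ n, X ^ n ∣ S (n + 1) - S n) : ∃ T, ∀ n, X ^ n ∣ T - S n := by
  have cauchy {n N : ℕ} (hnN : n ≤ N) : X ^ n ∣ S N - S n := by
    induction N, hnN using Nat.le_induction with
    | base => simp
    | succ N hnN ih => simpa using dvd_add ((pow_dvd_pow X hnN).trans (h N)) ih
  refine ⟨PowerSeries.mk fun n => PowerSeries.coeff n (S (n + 1)), fun N => ?_⟩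
  refine PowerSeries.X_pow_dvd_iff.2 fun n hn => ?_
  rw [map_sub, PowerSeries.coeff_mk, coeff_eq_of_X_pow_dvd_sub (cauchy hn) n.lt_succ_self, sub_self]

theorem ev₁_le_of_X_pow_dvd_sub {S : ℕ → PowerSeries ℝ} {T : PowerSeries ℝ}
    (h : ∀ n, X ^ n ∣ T - S n) {x b : ENNReal} (hb : ∀ n, ev₁ (S n) x ≤ b) : ev₁ T x ≤ b := by
  rw [ev₁_eq_tsum, ENNReal.tsum_eq_iSup_nat]
  refine iSup_le fun N => le_trans ?_ (hb N)
  rw [ev₁_eq_tsum]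
  refine le_of_eq_of_le (Finset.sum_congr rfl fun n hn => ?_) (ENNReal.sum_le_tsum (Finset.range N))
  rw [coeff_eq_of_X_pow_dvd_sub (h N) (Finset.mem_range.1 hn)]

variable {m : ℕ} {G : Fin m → MvPowerSeries (Fin (m + 1)) ℝ} {S T : Fin m → PowerSeries ℝ}

/-- The operator `T ↦ G(x, T(x))`, whose fixed points are the formal solutions of the system. -/
def picardMap (G : Fin m → MvPowerSeries (Fin (m + 1)) ℝ) (T : Fin m → PowerSeries ℝ) (i : Fin m) :
    PowerSeries ℝ :=
  MvPowerSeries.subst (Fin.cons X T : Fin (m + 1) → PowerSeries ℝ) (G i)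

theorem hasSubst_cons (hT : ∀ i, X ∣ T i) :
    MvPowerSeries.HasSubst (Fin.cons X T : Fin (m + 1) → PowerSeries ℝ) :=
  MvPowerSeries.hasSubst_of_constantCoeff_zero <|
    Fin.cases PowerSeries.constantCoeff_X fun i => PowerSeries.X_dvd_iff.1 (hT i)

theorem cons_X_mem_nonnegCoeff (hT : ∀ i, T i ∈ nonnegCoeff Unit) (i : Fin (m + 1)) :
    (Fin.cons X T : Fin (m + 1) → PowerSeries ℝ) i ∈ nonnegCoeff Unit :=
  Fin.cases (X_mem_nonnegCoeff ()) hT i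

theorem picardMap_mem_nonnegCoeff (hpos : ∀ i, G i ∈ nonnegCoeff _)
    (hT : ∀ i, T i ∈ nonnegCoeff Unit) (hT0 : ∀ i, X ∣ T i) (i : Fin m) :
    picardMap G T i ∈ nonnegCoeff Unit :=
  subst_mem_nonnegCoeff (hpos i) (cons_X_mem_nonnegCoeff hT) (hasSubst_cons hT0)

theorem X_dvd_picardMap (hX : ∀ i, MvPowerSeries.X 0 ∣ G i) (hT : ∀ i, X ∣ T i) (i : Fin m) :
    X ∣ picardMap G T i := by
  obtain ⟨A, hA⟩ := hX i
  rw [picardMap, hA, MvPowerSeries.subst_mul (hasSubst_cons hT),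
    MvPowerSeries.subst_X (hasSubst_cons hT)]
  exact dvd_mul_right _ _

theorem X_pow_succ_dvd_picardMap_sub (hX : ∀ i, MvPowerSeries.X 0 ∣ G i) (hS : ∀ i, X ∣ S i)
    (hT : ∀ i, X ∣ T i) {N : ℕ} (h : ∀ i, X ^ N ∣ S i - T i) (i : Fin m) :
    X ^ (N + 1) ∣ picardMap G S i - picardMap G T i := by
  have hcons : ∀ k, X ^ N ∣ (Fin.cons X S : Fin (m + 1) → PowerSeries ℝ) k -
      (Fin.cons X T : Fin (m + 1) → PowerSeries ℝ) k := Fin.cases (by simp) (by simpa using h)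
  obtain ⟨A, hA⟩ := hX i
  rw [picardMap, picardMap, hA, MvPowerSeries.subst_mul (hasSubst_cons hS),
    MvPowerSeries.subst_mul (hasSubst_cons hT), MvPowerSeries.subst_X (hasSubst_cons hS),
    MvPowerSeries.subst_X (hasSubst_cons hT), Fin.cons_zero, Fin.cons_zero, ← mul_sub, pow_succ']
  exact mul_dvd_mul_left _ (X_pow_dvd_subst_sub (hasSubst_cons hS) (hasSubst_cons hT) A hcons)

theorem X_dvd_iterate_picardMap (hX : ∀ i, MvPowerSeries.X 0 ∣ G i) (n : ℕ) (i : Fin m) :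
    X ∣ (picardMap G)^[n] 0 i := by
  induction n generalizing i with
  | zero => exact dvd_zero X
  | succ n ih =>
    rw [Function.iterate_succ_apply']
    exact X_dvd_picardMap hX ih i

theorem iterate_picardMap_mem_nonnegCoeff (hpos : ∀ i, G i ∈ nonnegCoeff _)
    (hX : ∀ i, MvPowerSeries.X 0 ∣ G i) (n : ℕ) (i : Fin m) :
    (picardMap G)^[n] 0 i ∈ nonnegCoeff Unit := by
  induction n generalizing i with
  | zero => exact zero_mem _
  | succ n ih =>
    rw [Function.iterate_succ_apply']
    exact picardMap_mem_nonnegCoeff hpos ih (X_dvd_iterate_picardMap hX n) i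

theorem IsStandardSolution.X_dvd (hT : IsStandardSolution G T) (i : Fin m) : X ∣ T i :=
  PowerSeries.X_dvd_iff.2 (hT.constantCoeff_eq_zero i)

theorem IsStandardSolution.mem_nonnegCoeff (hT : IsStandardSolution G T) (i : Fin m) :
    T i ∈ nonnegCoeff Unit := fun d => by
  have := hT.nonneg i (d ())
  rwa [PowerSeries.coeff, ← Finsupp.unique_single d] at this

theorem IsStandardSolution.X_pow_dvd_sub_iterate (hX : ∀ i, MvPowerSeries.X 0 ∣ G i)
    (hT : IsStandardSolution G T) (i : Fin m) (n : ℕ) :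
    X ^ n ∣ T i - (picardMap G)^[n] 0 i := by
  induction n generalizing i with
  | zero => simp
  | succ n ih =>
    rw [Function.iterate_succ_apply', hT.eq_subst i]
    exact X_pow_succ_dvd_picardMap_sub hX hT.X_dvd (X_dvd_iterate_picardMap hX n) ih i

theorem IsStandardSolution.unique (hX : ∀ i, MvPowerSeries.X 0 ∣ G i)
    (hS : IsStandardSolution G S) (hT : IsStandardSolution G T) : S = T := by
  funext i
  ext n
  rw [coeff_eq_of_X_pow_dvd_sub (hS.X_pow_dvd_sub_iterate hX i (n + 1)) n.lt_succ_self,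
    coeff_eq_of_X_pow_dvd_sub (hT.X_pow_dvd_sub_iterate hX i (n + 1)) n.lt_succ_self]

theorem exists_isStandardSolution (hpos : ∀ i, G i ∈ nonnegCoeff _)
    (hX : ∀ i, MvPowerSeries.X 0 ∣ G i) : ∃ T, IsStandardSolution G T := by
  have hS := X_dvd_iterate_picardMap hX
  have cauchy (i : Fin m) (n : ℕ) :
      X ^ n ∣ (picardMap G)^[n + 1] 0 i - (picardMap G)^[n] 0 i := by
    induction n generalizing i with
    | zero => simp
    | succ n ih =>
      have hdvd := X_pow_succ_dvd_picardMap_sub hX (hS (n + 1)) (hS n) ih i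
      rwa [← Function.iterate_succ_apply' (picardMap G),
        ← Function.iterate_succ_apply' (picardMap G)] at hdvd
  choose T hT using fun i =>
    exists_forall_X_pow_dvd_sub (S := fun n => (picardMap G)^[n] 0 i) (cauchy i)
  have hT0 (i : Fin m) : X ∣ T i := by
    simpa using dvd_add ((pow_one X).symm.dvd.trans (hT i 1)) (hS 1 i)
  refine ⟨T, fun i n => ?_, fun i => PowerSeries.X_dvd_iff.1 (hT0 i), fun i => ?_⟩
  · rw [coeff_eq_of_X_pow_dvd_sub (hT i (n + 1)) n.lt_succ_self]
    exact iterate_picardMap_mem_nonnegCoeff hpos hX _ i _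
  · ext n
    rw [coeff_eq_of_X_pow_dvd_sub (hT i (n + 1)) n.lt_succ_self, Function.iterate_succ_apply']
    exact (coeff_eq_of_X_pow_dvd_sub
      (X_pow_succ_dvd_picardMap_sub hX hT0 (hS n) (fun i => hT i n) i) n.lt_succ_self).symm

/-- The point `(x, T(x))`. -/
def curve (T : Fin m → PowerSeries ℝ) (x : ENNReal) : Fin (m + 1) → ENNReal :=
  Fin.cons x fun i => ev₁ (T i) x

theorem ev_cons_X (T : Fin m → PowerSeries ℝ) (x : ENNReal) :
    (fun k => ev ((Fin.cons X T : Fin (m + 1) → PowerSeries ℝ) k) fun _ => x) = curve T x :=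
  funext <| Fin.cases (ev_X () _) fun _ => rfl

theorem ev₁_picardMap (hpos : ∀ i, G i ∈ nonnegCoeff _) (hT : ∀ i, T i ∈ nonnegCoeff Unit)
    (hT0 : ∀ i, X ∣ T i) (x : ENNReal) (i : Fin m) :
    ev₁ (picardMap G T i) x = ev (G i) (curve T x) := by
  rw [ev₁, picardMap, ev_subst (hpos i) (cons_X_mem_nonnegCoeff hT) (hasSubst_cons hT0), ev_cons_X]

theorem IsStandardSolution.ev_curve (hpos : ∀ i, G i ∈ nonnegCoeff _)
    (hT : IsStandardSolution G T) (x : ENNReal) (i : Fin m) :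
    ev (G i) (curve T x) = curve T x i.succ := by
  rw [← ev₁_picardMap hpos hT.mem_nonnegCoeff hT.X_dvd, picardMap, ← hT.eq_subst i]
  rfl

theorem IsStandardSolution.curve_le_of_supersolution (hpos : ∀ i, G i ∈ nonnegCoeff _)
    (hX : ∀ i, MvPowerSeries.X 0 ∣ G i) (hT : IsStandardSolution G T) {P : Fin (m + 1) → ENNReal}
    (hP : ∀ i, ev (G i) P ≤ P i.succ) : curve T (P 0) ≤ P := by
  have iterate_le (n : ℕ) : curve ((picardMap G)^[n] 0) (P 0) ≤ P := by
    induction n with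
    | zero => exact Fin.cases le_rfl fun i => (ev_zero _).trans_le zero_le
    | succ n ih =>
      refine Fin.cases le_rfl fun i => ?_
      rw [curve, Fin.cons_succ, Function.iterate_succ_apply', ev₁_picardMap hpos
        (iterate_picardMap_mem_nonnegCoeff hpos hX n) (X_dvd_iterate_picardMap hX n)]
      exact (ev_mono _ ih).trans (hP i)
  exact Fin.cases le_rfl fun i =>
    ev₁_le_of_X_pow_dvd_sub (hT.X_pow_dvd_sub_iterate hX i) fun n => iterate_le n i.succ

end FormalSolution

section Subinvariance

variable {n : Type*} [Fintype n] {A B : Matrix n n ENNReal} {u v w : n → ENNReal}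

theorem mulVec_mono (hAB : ∀ i j, A i j ≤ B i j) (huv : u ≤ v) : A *ᵥ u ≤ B *ᵥ v := fun i =>
  Finset.sum_le_sum fun j _ => mul_le_mul' (hAB i j) (huv j)

theorem apply_mul_le_mulVec (A : Matrix n n ENNReal) (v : n → ENNReal) (i j : n) :
    A i j * v j ≤ (A *ᵥ v) i :=
  Finset.single_le_sum_of_canonicallyOrdered (f := fun j => A i j * v j) (Finset.mem_univ j)

theorem exists_mul_le_of_mulVec_le {i j : n}
    (h : Relation.ReflTransGen (fun k l => A k l ≠ 0) i j) :
    ∃ C : ENNReal, C ≠ 0 ∧ ∀ v, A *ᵥ v ≤ v → C * v j ≤ v i := by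
  induction h with
  | refl => exact ⟨1, one_ne_zero, fun v _ => by rw [one_mul]⟩
  | @tail l j _ hlj ih =>
    obtain ⟨C, hC, hCv⟩ := ih
    refine ⟨C * A l j, mul_ne_zero hC hlj, fun v hv => ?_⟩
    rw [mul_assoc]
    exact (mul_le_mul_right ((apply_mul_le_mulVec A v l j).trans (hv l)) C).trans (hCv v hv)

theorem eq_zero_of_le_mulVec_of_mulVec_lt (hu : ∀ i, (A *ᵥ u) i < u i) (hu_top : ∀ i, u i ≠ ⊤)
    (hw : w ≤ A *ᵥ w) (hw_top : ∀ i, w i ≠ ⊤) : w = 0 := by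
  cases isEmpty_or_nonempty n
  · exact Subsingleton.elim _ _
  have hu0 (i : n) : u i ≠ 0 := (zero_le.trans_lt (hu i)).ne'
  obtain ⟨i, hi⟩ := Finite.exists_max fun i => w i / u i
  have hle : w ≤ (w i / u i) • u := fun j => (ENNReal.div_le_iff (hu0 j) (hu_top j)).1 (hi j)
  suffices w i = 0 by
    rw [this, ENNReal.zero_div, zero_smul] at hle
    exact le_antisymm hle fun _ => zero_le
  by_contra hwi
  have hlt : w i < w i := calc
    w i ≤ (A *ᵥ w) i := hw i
    _ ≤ (A *ᵥ ((w i / u i) • u)) i := mulVec_mono (fun _ _ => le_rfl) hle i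
    _ = w i / u i * (A *ᵥ u) i := by rw [Matrix.mulVec_smul, Pi.smul_apply, smul_eq_mul]
    _ < w i / u i * u i := (ENNReal.mul_lt_mul_iff_right (ENNReal.div_ne_zero.2 ⟨hwi, hu_top i⟩)
        (ENNReal.div_ne_top (hw_top i) (hu0 i))).2 (hu i)
    _ = w i := ENNReal.div_mul_cancel (hu0 i) (hu_top i)
  exact hlt.false

end Subinvariance

section Jacobian

variable {m : ℕ} {G : Fin m → MvPowerSeries (Fin (m + 1)) ℝ} {p q : Fin (m + 1) → ENNReal}

/-- The Jacobian matrix `(∂ G_i / ∂ y_j)` at a point of `[0, ∞] ^ (m + 1)`, with entries in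
`[0, ∞]`. -/
def jacobianENN (G : Fin m → MvPowerSeries (Fin (m + 1)) ℝ) (p : Fin (m + 1) → ENNReal) :
    Matrix (Fin m) (Fin m) ENNReal :=
  Matrix.of fun i j => ev (partialY G i j) p

theorem jacobianENN_mono (hpq : p ≤ q) (i j : Fin m) : jacobianENN G p i j ≤ jacobianENN G q i j :=
  ev_mono _ hpq

theorem sum_mul_ev_pderiv_eq_add_mulVec (G : Fin m → MvPowerSeries (Fin (m + 1)) ℝ)
    (p h : Fin (m + 1) → ENNReal) (i : Fin m) :
    ∑ k, h k * ev (MvPowerSeries.pderiv ℝ k (G i)) p =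
      h 0 * ev (MvPowerSeries.pderiv ℝ 0 (G i)) p + (jacobianENN G p *ᵥ Fin.tail h) i := by
  rw [Fin.sum_univ_succ, Matrix.mulVec, dotProduct]
  exact congrArg _ (Finset.sum_congr rfl fun j _ => mul_comm _ _)

theorem ev_add_jacobianENN_mulVec_le (G : Fin m → MvPowerSeries (Fin (m + 1)) ℝ)
    (p h : Fin (m + 1) → ENNReal) (i : Fin m) :
    ev (G i) p + (h 0 * ev (MvPowerSeries.pderiv ℝ 0 (G i)) p +
      (jacobianENN G p *ᵥ Fin.tail h) i) ≤ ev (G i) (p + h) := by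
  rw [← sum_mul_ev_pderiv_eq_add_mulVec]
  exact ev_add_sum_pderiv_le (G i) p h

theorem partialY_mem_nonnegCoeff (hpos : ∀ i, G i ∈ nonnegCoeff _) (i j : Fin m) :
    partialY G i j ∈ nonnegCoeff _ :=
  pderiv_mem_nonnegCoeff (hpos i) j.succ

end Jacobian

section WellConditioned

variable {m : ℕ} {G : Fin m → MvPowerSeries (Fin (m + 1)) ℝ} {T : Fin m → PowerSeries ℝ}

theorem IsWellConditioned.X_dvd (hG : IsWellConditioned G) (i : Fin m) :
    MvPowerSeries.X 0 ∣ G i :=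
  MvPowerSeries.X_dvd_iff.2 (hG.zero_left i)

theorem IsWellConditioned.nonempty (hG : IsWellConditioned G) : Nonempty (Fin m) :=
  ⟨hG.nonlinear.choose⟩

theorem IsWellConditioned.pderiv_zero_ne_zero (hG : IsWellConditioned G) (i : Fin m) :
    MvPowerSeries.pderiv ℝ 0 (G i) ≠ 0 := by
  obtain ⟨n, hn⟩ := hG.zero_right i
  cases n with
  | zero => exact absurd (hG.zero_left i _ (by simp)) hn
  | succ n =>
    intro h
    have hcoeff := MvPowerSeries.coeff_pderiv (R := ℝ) (i := 0) (G i) (Finsupp.single 0 n)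
    rw [h, map_zero, ← Finsupp.single_add] at hcoeff
    exact mul_ne_zero hn (by positivity) hcoeff.symm

theorem IsWellConditioned.reflTransGen_jacobianENN_ne_zero (hG : IsWellConditioned G)
    {p : Fin (m + 1) → ENNReal} (hp : ∀ k, p k ≠ 0) (i j : Fin m) :
    Relation.ReflTransGen (fun k l => jacobianENN G p k l ≠ 0) i j :=
  (hG.irreducible i j).lift id fun k l hkl =>
    ev_ne_zero (partialY_mem_nonnegCoeff hG.nonneg k l) hkl hp

theorem IsHolomorphicNearZero.eventually_ev_ne_top {k : ℕ} {A : MvPowerSeries (Fin k) ℝ}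
    (hA : IsHolomorphicNearZero A) : ∀ᶠ r : ℝ in 𝓝[>] 0, ev A (fun _ => ENNReal.ofReal r) ≠ ⊤ := by
  obtain ⟨f, -, hf⟩ := hA
  have hdiag : Tendsto (fun r : ℝ => fun _ : Fin k => (r : ℂ)) (𝓝 0) (𝓝 0) := by
    refine tendsto_pi_nhds.2 fun _ => ?_
    simpa using Complex.continuous_ofReal.tendsto 0
  filter_upwards [(hdiag.mono_left nhdsWithin_le_nhds).eventually hf, self_mem_nhdsWithin]
    with r hr hpos
  have hsum : Summable fun d : Fin k →₀ ℕ => MvPowerSeries.coeff d A * ∏ i, r ^ d i :=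
    mod_cast hr.summable
  exact (evalNN_eq_ev A (c := fun _ => r) fun _ => le_of_lt hpos) ▸ hsum.tsum_ofReal_ne_top

theorem curve_mono (T : Fin m → PowerSeries ℝ) : Monotone (curve T) := fun _ _ h =>
  Fin.cases h fun i => ev₁_mono (T i) h

namespace IsStandardSolution

theorem curve_ne_zero (hG : IsWellConditioned G) (hT : IsStandardSolution G T) {x : ENNReal}
    (hx : x ≠ 0) : ∀ k, curve T x k ≠ 0 :=
  Fin.cases hx fun i => by
    obtain ⟨n, hn⟩ := hG.zero_right i
    rw [← hT.ev_curve hG.nonneg]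
    refine ev_ne_zero_of_coeff_pos ((hG.nonneg i _).lt_of_ne' hn) fun k hk => ?_
    rwa [Finset.mem_singleton.1 (Finsupp.support_single_subset hk)]

theorem exists_mul_ev₁_le (hG : IsWellConditioned G) (hT : IsStandardSolution G T) {x₀ : ENNReal}
    (hx₀ : x₀ ≠ 0) (i j : Fin m) :
    ∃ C : ENNReal, C ≠ 0 ∧ ∀ x, x₀ ≤ x → C * ev₁ (T j) x ≤ ev₁ (T i) x := by
  have h2 : (2⁻¹ : ENNReal) ≠ 0 := by simp
  have hhalf (k : Fin (m + 1)) : ((2⁻¹ : ENNReal) • curve T x₀) k ≠ 0 :=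
    mul_ne_zero h2 (hT.curve_ne_zero hG hx₀ k)
  obtain ⟨C, hC, hCle⟩ := exists_mul_le_of_mulVec_le
    (A := (2⁻¹ : ENNReal) • jacobianENN G ((2⁻¹ : ENNReal) • curve T x₀))
    ((hG.reflTransGen_jacobianENN_ne_zero hhalf i j).lift id fun _ _ hkl => mul_ne_zero h2 hkl)
  refine ⟨C, hC, fun x hx => hCle (Fin.tail (curve T x)) fun k => ?_⟩
  rw [Matrix.smul_mulVec, ← Matrix.mulVec_smul]
  have hmono : (2⁻¹ : ENNReal) • curve T x₀ ≤ (2⁻¹ : ENNReal) • curve T x := fun l =>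
    mul_le_mul_right (curve_mono T hx l) _
  calc (jacobianENN G ((2⁻¹ : ENNReal) • curve T x₀) *ᵥ (2⁻¹ : ENNReal) • Fin.tail (curve T x)) k
      ≤ (jacobianENN G ((2⁻¹ : ENNReal) • curve T x) *ᵥ
          Fin.tail ((2⁻¹ : ENNReal) • curve T x)) k :=
        mulVec_mono (jacobianENN_mono hmono) le_rfl k
    _ ≤ ev (G k) ((2⁻¹ : ENNReal) • curve T x + (2⁻¹ : ENNReal) • curve T x) :=
        (le_add_self.trans le_add_self).trans (ev_add_jacobianENN_mulVec_le G _ _ k)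
    _ = ev (G k) (curve T x) := by rw [← add_smul, ENNReal.inv_two_add_inv_two, one_smul]
    _ = Fin.tail (curve T x) k := hT.ev_curve hG.nonneg x k

theorem ev₁_ne_top_of_ev₁_ne_top (hG : IsWellConditioned G) (hT : IsStandardSolution G T)
    {x : ENNReal} {i : Fin m} (h : ev₁ (T i) x ≠ ⊤) (j : Fin m) : ev₁ (T j) x ≠ ⊤ := by
  obtain rfl | hx := eq_or_ne x 0
  · have h0 : ev₁ (T j) 0 = 0 := by
      refine (ev₁_eq_tsum _ _).trans (ENNReal.tsum_eq_zero.2 fun n => ?_)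
      cases n <;> simp [hT.constantCoeff_eq_zero j]
    exact h0.trans_ne ENNReal.zero_ne_top
  · obtain ⟨C, hC, hle⟩ := hT.exists_mul_ev₁_le hG hx i j
    intro htop
    refine h (top_le_iff.1 ((hle x le_rfl).trans' ?_))
    rw [htop, ENNReal.mul_top hC]

theorem exists_ev₁_le_of_ne_top (hG : IsWellConditioned G) (hT : IsStandardSolution G T)
    {x₀ : ENNReal} (hx₀ : x₀ ≠ 0) :
    ∃ i B, B ≠ ⊤ ∧ ∀ x, x₀ ≤ x → ev₁ (T i) x ≠ ⊤ → ev₁ (T i) x ≤ B := by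
  obtain ⟨i, j, k, hijk⟩ := hG.nonlinear
  obtain ⟨C, hC, hCle⟩ := hT.exists_mul_ev₁_le hG hx₀ j i
  obtain ⟨D, hD, hDle⟩ := hT.exists_mul_ev₁_le hG hx₀ k i
  have h3 : (3⁻¹ : ENNReal) ≠ 0 := by simp
  set c := ev (MvPowerSeries.pderiv ℝ k.succ (partialY G i j)) ((3⁻¹ : ENNReal) • curve T x₀)
  have hc : c ≠ 0 := ev_ne_zero
    (pderiv_mem_nonnegCoeff (partialY_mem_nonnegCoeff hG.nonneg i j) k.succ) hijk
    fun l => mul_ne_zero h3 (hT.curve_ne_zero hG hx₀ l)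
  set E := (3⁻¹ * C) * ((3⁻¹ * D) * c)
  have hE : E ≠ 0 := mul_ne_zero (mul_ne_zero h3 hC) (mul_ne_zero (mul_ne_zero h3 hD) hc)
  refine ⟨i, E⁻¹, ENNReal.inv_ne_top.2 hE, fun x hx htop => ?_⟩
  have hxi : ev₁ (T i) x ≠ 0 := hT.curve_ne_zero hG (ne_bot_of_le_ne_bot hx₀ hx) i.succ
  have hquad : ev₁ (T i) x * E * ev₁ (T i) x ≤ 1 * ev₁ (T i) x := by
    set h := (3⁻¹ : ENNReal) • curve T x with hh
    calc ev₁ (T i) x * E * ev₁ (T i) x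
        = 3⁻¹ * (C * ev₁ (T i) x) * (3⁻¹ * (D * ev₁ (T i) x) * c) := by ring
      _ ≤ h j.succ * (h k.succ * ev (MvPowerSeries.pderiv ℝ k.succ (partialY G i j)) h) := by
        refine mul_le_mul' (mul_le_mul_right (hCle x hx) _)
          (mul_le_mul' (mul_le_mul_right (hDle x hx) _) (ev_mono _ fun l => ?_))
        exact mul_le_mul_right (curve_mono T hx l) _
      _ ≤ ev (G i) (h + h + h) := mul_mul_ev_pderiv_pderiv_le (G i) h h j.succ k.succ
      _ = ev (G i) (curve T x) := by
        rw [hh, ← add_smul, ← add_smul, ENNReal.inv_three_add_inv_three, one_smul]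
      _ = 1 * ev₁ (T i) x := (hT.ev_curve hG.nonneg x i).trans (one_mul _).symm
  exact ENNReal.le_inv_iff_mul_le.2 ((ENNReal.mul_le_mul_iff_left hxi htop).1 hquad)

theorem exists_curve_ne_top (hG : IsWellConditioned G) (hT : IsStandardSolution G T) :
    ∃ x : ENNReal, x ≠ 0 ∧ ∀ k, curve T x k ≠ ⊤ := by
  obtain ⟨r, hr, hr0⟩ := ((eventually_all.2 fun i =>
    (hG.holomorphic i).eventually_ev_ne_top).and self_mem_nhdsWithin).exists
  set p : Fin (m + 1) → ENNReal := fun _ => ENNReal.ofReal r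
  have hp0 : ENNReal.ofReal r ≠ 0 := (ENNReal.ofReal_pos.2 hr0).ne'
  obtain ⟨t, ht0, ht⟩ := ENNReal.exists_nnreal_pos_mul_lt
    (ENNReal.sum_ne_top.2 fun i (_ : i ∈ Finset.univ) => hr i) hp0
  have ht1 : min (t : ENNReal) 1 ≤ 1 := min_le_right _ _
  set x := min (t : ENNReal) 1 * ENNReal.ofReal r
  have hxp : (Fin.cons x (Fin.tail p) : Fin (m + 1) → ENNReal) ≤ p :=
    Fin.cases (mul_le_of_le_one_left' ht1) fun _ => le_rfl
  have hle : curve T x ≤ Fin.cons x (Fin.tail p) :=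
    hT.curve_le_of_supersolution hG.nonneg hG.X_dvd (P := Fin.cons x (Fin.tail p)) fun i =>
      calc ev (G i) (Fin.cons x (Fin.tail p)) ≤ min (t : ENNReal) 1 * ev (G i) p :=
            ev_le_mul_ev_of_X_dvd (hG.X_dvd i) hxp ht1 le_rfl
        _ ≤ t * ∑ i, ev (G i) p := mul_le_mul' (min_le_left _ _)
            (Finset.single_le_sum_of_canonicallyOrdered (f := fun i => ev (G i) p)
              (Finset.mem_univ i))
        _ ≤ ENNReal.ofReal r := ht.le
  exact ⟨x, mul_ne_zero (by simpa using ht0.ne') hp0,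
    fun k => ne_top_of_le_ne_top ENNReal.ofReal_ne_top ((hle.trans hxp) k)⟩

theorem radius_eq_radius (hG : IsWellConditioned G) (hT : IsStandardSolution G T) (i j : Fin m) :
    radius (T i) = radius (T j) := by
  have hle (i j : Fin m) : radius (T i) ≤ radius (T j) :=
    le_of_forall_lt_imp_le_of_dense fun x hx =>
      le_radius_of_ev₁_ne_top (hT.mem_nonnegCoeff j) hx.ne_top
        (hT.ev₁_ne_top_of_ev₁_ne_top hG (ev₁_ne_top_of_lt_radius (hT.mem_nonnegCoeff i) hx) j)
  exact le_antisymm (hle i j) (hle j i)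

theorem radius_ne_zero (hG : IsWellConditioned G) (hT : IsStandardSolution G T) (i : Fin m) :
    radius (T i) ≠ 0 := by
  obtain ⟨x, hx0, hx⟩ := hT.exists_curve_ne_top hG
  exact ne_bot_of_le_ne_bot hx0
    (le_radius_of_ev₁_ne_top (hT.mem_nonnegCoeff i) (hx 0) (hx i.succ))

theorem ev₁_radius_ne_top (hG : IsWellConditioned G) (hT : IsStandardSolution G T) (i j : Fin m) :
    ev₁ (T i) (radius (T j)) ≠ ⊤ := by
  obtain ⟨x₀, hx₀, hx₀j⟩ := exists_between (pos_iff_ne_zero.2 (hT.radius_ne_zero hG j))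
  obtain ⟨k, B, hB, hle⟩ := hT.exists_ev₁_le_of_ne_top hG hx₀.ne'
  have : (𝓝[<] radius (T j)).NeBot := nhdsLT_neBot_of_exists_lt ⟨x₀, hx₀j⟩
  have hk : ev₁ (T k) (radius (T j)) ≤ B := by
    refine le_of_tendsto (tendsto_ev₁_nhdsLT (T k) _) ?_
    filter_upwards [Ioo_mem_nhdsLT hx₀j] with x hx
    refine hle x hx.1.le (ev₁_ne_top_of_lt_radius (hT.mem_nonnegCoeff k) ?_)
    rw [hT.radius_eq_radius hG k j]
    exact hx.2
  exact hT.ev₁_ne_top_of_ev₁_ne_top hG (ne_top_of_le_ne_top hB hk) i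

theorem radius_ne_top (hG : IsWellConditioned G) (hT : IsStandardSolution G T) (i : Fin m) :
    radius (T i) ≠ ⊤ := by
  intro htop
  have h1 : ev₁ (T i) 1 ≠ 0 := hT.curve_ne_zero hG one_ne_zero i.succ
  have hfin : ev₁ (T i) ⊤ ≠ ⊤ := htop ▸ hT.ev₁_radius_ne_top hG i i
  refine hfin (top_le_iff.1 ?_)
  calc ⊤ = ⊤ * ev₁ (T i) 1 := (ENNReal.top_mul h1).symm
    _ ≤ ev₁ (T i) (⊤ * 1) := mul_ev₁_le_ev₁_mul (hT.constantCoeff_eq_zero i) le_top 1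
    _ = ev₁ (T i) ⊤ := by rw [mul_one]

end IsStandardSolution

end WellConditioned

section Singularity

variable {σ : Type*} [Fintype σ] {A : MvPowerSeries σ ℝ} {p h : σ → ENNReal}

theorem eventually_add_mul_lt {a b c : ENNReal} (hc : c ≠ ⊤) (hab : a < b) :
    ∀ᶠ t in 𝓝[>] (0 : ENNReal), a + t * c < b := by
  have htend : Tendsto (fun t => a + t * c) (𝓝[>] 0) (𝓝 (a + 0 * c)) :=
    (ENNReal.Tendsto.mul_const tendsto_id (Or.inr hc)).const_add a |>.mono_left nhdsWithin_le_nhds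
  exact htend.eventually_lt_const (by rwa [zero_mul, add_zero])

theorem eventually_ev_add_smul_le {w : ENNReal}
    (hlt : ∑ j, h j * ev (MvPowerSeries.pderiv ℝ j A) p < w) (htop : ev A (p + h) ≠ ⊤) :
    ∀ᶠ t in 𝓝[>] (0 : ENNReal), ev A (p + t • h) ≤ ev A p + t * w := by
  filter_upwards [eventually_add_mul_lt htop hlt, Ioo_mem_nhdsGT one_pos] with t hw ht
  calc ev A (p + t • h)
      ≤ ev A p + t * ∑ j, h j * ev (MvPowerSeries.pderiv ℝ j A) p + t ^ 2 * ev A (p + h) :=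
        ev_add_smul_le A p h ht.2.le
    _ = ev A p + t * (∑ j, h j * ev (MvPowerSeries.pderiv ℝ j A) p + t * ev A (p + h)) := by ring
    _ ≤ ev A p + t * w := by gcongr

variable {n : Type*} [Fintype n] {M : Matrix n n ENNReal}

theorem exists_apply_le_of_mulVec_le {i j : n}
    (hM : Relation.ReflTransGen (fun k l => M k l ≠ 0) j i) :
    ∃ B : ENNReal, B ≠ ⊤ ∧ ∀ N : Matrix n n ENNReal, (∀ k l, M k l ≤ N k l) →
      ∀ v, v j ≠ 0 → v j ≠ ⊤ → N *ᵥ v ≤ v → N i j ≤ B := by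
  obtain ⟨C, hC, hCle⟩ := exists_mul_le_of_mulVec_le hM
  refine ⟨C⁻¹, ENNReal.inv_ne_top.2 hC, fun N hMN v hv0 hv hNv => ?_⟩
  rw [ENNReal.le_inv_iff_mul_le, ← ENNReal.mul_le_mul_iff_left hv0 hv, one_mul]
  calc N i j * C * v j = C * (N i j * v j) := by ring
    _ ≤ C * v i := mul_le_mul_right ((apply_mul_le_mulVec N v i j).trans (hNv i)) C
    _ ≤ v j := hCle v ((mulVec_mono hMN le_rfl).trans hNv)

variable {m : ℕ} {G : Fin m → MvPowerSeries (Fin (m + 1)) ℝ} {T : Fin m → PowerSeries ℝ}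

theorem add_jacobianENN_mulVec_sub_le {p q : Fin (m + 1) → ENNReal} {i : Fin m} (hpq : p ≤ q)
    (hp : ev (G i) p = p i.succ) (hq : ev (G i) q = q i.succ) (hfin : p i.succ ≠ ⊤) :
    (q - p) 0 * ev (MvPowerSeries.pderiv ℝ 0 (G i)) p +
      (jacobianENN G p *ᵥ Fin.tail (q - p)) i ≤ Fin.tail (q - p) i := by
  have hle := ev_add_jacobianENN_mulVec_le G p (q - p) i
  rw [add_tsub_cancel_of_le hpq, hp, hq] at hle
  exact ENNReal.le_sub_of_add_le_left hfin hle

theorem tendsto_ev_curve_nhdsLT {A : MvPowerSeries (Fin (m + 1)) ℝ} (hA : A ∈ nonnegCoeff _)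
    (hT : ∀ i, T i ∈ nonnegCoeff Unit) (hT0 : ∀ i, PowerSeries.X ∣ T i) (x : ENNReal) :
    Tendsto (fun x => ev A (curve T x)) (𝓝[<] x) (𝓝 (ev A (curve T x))) := by
  have heq (x : ENNReal) : ev A (curve T x) =
      ev₁ (MvPowerSeries.subst (Fin.cons PowerSeries.X T : Fin (m + 1) → PowerSeries ℝ) A) x := by
    rw [ev₁, ev_subst hA (cons_X_mem_nonnegCoeff hT) (hasSubst_cons hT0), ev_cons_X]
  simp only [heq]
  exact tendsto_ev₁_nhdsLT _ x

namespace IsStandardSolution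

theorem jacobianENN_mulVec_sub_lt (hG : IsWellConditioned G) (hT : IsStandardSolution G T)
    {x y : ENNReal} (hx : x ≠ 0) (hxy : x < y) (hy : ∀ k, curve T y k ≠ ⊤) (i : Fin m) :
    (jacobianENN G (curve T x) *ᵥ Fin.tail (curve T y - curve T x)) i <
      Fin.tail (curve T y - curve T x) i := by
  have hmono : curve T x ≤ curve T y := curve_mono T hxy.le
  have hle := add_jacobianENN_mulVec_sub_le hmono (hT.ev_curve hG.nonneg x i)
    (hT.ev_curve hG.nonneg y i) (ne_top_of_le_ne_top (hy i.succ) (hmono i.succ))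
  have hpos : (curve T y - curve T x) 0 * ev (MvPowerSeries.pderiv ℝ 0 (G i)) (curve T x) ≠ 0 :=
    mul_ne_zero (tsub_pos_of_lt hxy).ne' (ev_ne_zero (pderiv_mem_nonnegCoeff (hG.nonneg i) 0)
      (hG.pderiv_zero_ne_zero i) (hT.curve_ne_zero hG hx))
  have hfin : (jacobianENN G (curve T x) *ᵥ Fin.tail (curve T y - curve T x)) i ≠ ⊤ :=
    ne_top_of_le_ne_top (ENNReal.sub_ne_top (hy i.succ)) (le_add_self.trans hle)
  exact (ENNReal.lt_add_right hfin hpos).trans_le ((add_comm _ _).trans_le hle)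

theorem tendsto_jacobianENN_curve (hG : IsWellConditioned G) (hT : IsStandardSolution G T)
    (x : ENNReal) (i j : Fin m) :
    Tendsto (fun x => jacobianENN G (curve T x) i j) (𝓝[<] x)
      (𝓝 (jacobianENN G (curve T x) i j)) :=
  tendsto_ev_curve_nhdsLT (partialY_mem_nonnegCoeff hG.nonneg i j) hT.mem_nonnegCoeff hT.X_dvd x

theorem jacobianENN_curve_ne_top (hG : IsWellConditioned G) (hT : IsStandardSolution G T)
    {y : ENNReal} (hy0 : y ≠ 0) (hy : ∀ k, curve T y k ≠ ⊤) (i j : Fin m) :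
    jacobianENN G (curve T y) i j ≠ ⊤ := by
  obtain ⟨x₀, hx₀, hx₀y⟩ := exists_between (pos_iff_ne_zero.2 hy0)
  have : (𝓝[<] y).NeBot := nhdsLT_neBot_of_exists_lt ⟨x₀, hx₀y⟩
  obtain ⟨B, hB, hle⟩ := exists_apply_le_of_mulVec_le
    (hG.reflTransGen_jacobianENN_ne_zero (hT.curve_ne_zero hG hx₀.ne') j i)
  refine ne_top_of_le_ne_top hB (le_of_tendsto (hT.tendsto_jacobianENN_curve hG y i j) ?_)
  filter_upwards [Ioo_mem_nhdsLT hx₀y] with x hx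
  have hlt := hT.jacobianENN_mulVec_sub_lt hG (hx₀.trans hx.1).ne' hx.2 hy
  exact hle _ (jacobianENN_mono (curve_mono T hx.1.le)) (Fin.tail (curve T y - curve T x))
    (zero_le.trans_lt (hlt j)).ne' (ENNReal.sub_ne_top (hy j.succ)) fun k => (hlt k).le

theorem exists_jacobianENN_mulVec_le (hG : IsWellConditioned G) (hT : IsStandardSolution G T)
    {y : ENNReal} (hy0 : y ≠ 0) (hy : ∀ k, curve T y k ≠ ⊤) {w : Fin m → ENNReal}
    (hw : ∀ i, w i ≠ ⊤) : ∃ i, (jacobianENN G (curve T y) *ᵥ w) i ≤ w i := by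
  by_contra! hlt
  have : (𝓝[<] y).NeBot := nhdsLT_neBot_of_exists_lt ⟨0, pos_iff_ne_zero.2 hy0⟩
  have htend (i : Fin m) : Tendsto (fun x => (jacobianENN G (curve T x) *ᵥ w) i) (𝓝[<] y)
      (𝓝 ((jacobianENN G (curve T y) *ᵥ w) i)) := by
    simp only [Matrix.mulVec, dotProduct]
    exact tendsto_finsetSum _ fun j _ =>
      ENNReal.Tendsto.mul_const (hT.tendsto_jacobianENN_curve hG y i j) (Or.inr (hw j))
  obtain ⟨x, hwx, hx⟩ := ((eventually_all.2 fun i => (htend i).eventually_const_lt (hlt i)).and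
    (Ioo_mem_nhdsLT (pos_iff_ne_zero.2 hy0))).exists
  have hw0 : w = 0 := eq_zero_of_le_mulVec_of_mulVec_lt
    (hT.jacobianENN_mulVec_sub_lt hG hx.1.ne' hx.2 hy)
    (fun i => ENNReal.sub_ne_top (hy i.succ)) (fun i => (hwx i).le) hw
  have := hG.nonempty
  simpa [hw0] using hlt (Classical.arbitrary _)

theorem exists_gt_curve_ne_top_of_add_lt (hG : IsWellConditioned G) (hT : IsStandardSolution G T)
    {x : ENNReal} (hx : ∀ k, curve T x k ≠ ⊤) {h : Fin (m + 1) → ENNReal} (h0 : h 0 ≠ 0)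
    (hfin : ∀ k, h k ≠ ⊤) (hev : ∀ i, ev (G i) (curve T x + h) ≠ ⊤)
    (hlt : ∀ i, h 0 * ev (MvPowerSeries.pderiv ℝ 0 (G i)) (curve T x) +
      (jacobianENN G (curve T x) *ᵥ Fin.tail h) i < h i.succ) :
    ∃ y, x < y ∧ ∀ k, curve T y k ≠ ⊤ := by
  simp only [← sum_mul_ev_pderiv_eq_add_mulVec] at hlt
  have : (𝓝[>] (0 : ENNReal)).NeBot := nhdsGT_neBot_of_exists_gt ⟨1, one_pos⟩
  obtain ⟨t, ht, ht01⟩ := ((eventually_all.2 fun i =>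
    eventually_ev_add_smul_le (hlt i) (hev i)).and (Ioo_mem_nhdsGT one_pos)).exists
  simp only [hT.ev_curve hG.nonneg] at ht
  have hle := hT.curve_le_of_supersolution hG.nonneg hG.X_dvd (P := curve T x + t • h) ht
  refine ⟨x + t * h 0, ENNReal.lt_add_right (hx 0) (mul_ne_zero ht01.1.ne' h0),
    fun k => ne_top_of_le_ne_top ?_ (hle k)⟩
  exact ENNReal.add_ne_top.2 ⟨hx k, ENNReal.mul_ne_top ht01.2.ne_top (hfin k)⟩

theorem exists_gt_curve_ne_top (hG : IsWellConditioned G) (hT : IsStandardSolution G T)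
    {x : ENNReal} (hx : ∀ k, curve T x k ≠ ⊤) {h : Fin (m + 1) → ENNReal} (h0 : h 0 ≠ 0)
    (hfin : ∀ k, h k ≠ ⊤) (hev : ∀ i, ev (G i) (curve T x + h) ≠ ⊤)
    (hlt : ∀ i, (jacobianENN G (curve T x) *ᵥ Fin.tail h) i < h i.succ) :
    ∃ y, x < y ∧ ∀ k, curve T y k ≠ ⊤ := by
  have hD (i : Fin m) : h 0 * ev (MvPowerSeries.pderiv ℝ 0 (G i)) (curve T x) ≠ ⊤ :=
    ne_top_of_le_ne_top (hev i) (mul_ev_pderiv_le (G i) _ h 0)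
  have : (𝓝[>] (0 : ENNReal)).NeBot := nhdsGT_neBot_of_exists_gt ⟨1, one_pos⟩
  obtain ⟨t, ht, ht01⟩ := ((eventually_all.2 fun i =>
    eventually_add_mul_lt (hD i) (hlt i)).and (Ioo_mem_nhdsGT one_pos)).exists
  have hle : (Fin.cons (t * h 0) (Fin.tail h) : Fin (m + 1) → ENNReal) ≤ h :=
    Fin.cases (mul_le_of_le_one_left' ht01.2.le) fun _ => le_rfl
  refine hT.exists_gt_curve_ne_top_of_add_lt hG hx (h := Fin.cons (t * h 0) (Fin.tail h))
    (mul_ne_zero ht01.1.ne' h0) (fun k => ne_top_of_le_ne_top (hfin k) (hle k))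
    (fun i => ne_top_of_le_ne_top (hev i) (ev_mono _ (add_le_add_right hle _))) fun i => ?_
  rw [Fin.cons_zero, Fin.tail_cons, mul_assoc, add_comm]
  exact ht i

end IsStandardSolution

end Singularity

section Eigenpoint

theorem ev_add_add_le {σ : Type*} [Fintype σ] (A : MvPowerSeries σ ℝ) (p g : σ → ENNReal) :
    ev A (p + g + g) + ∑ j, g j * ∑ k, g k *
        ev (MvPowerSeries.pderiv ℝ k (MvPowerSeries.pderiv ℝ j A)) (p + g) ≤
      ev A p + ∑ j, (g + g) j * ev (MvPowerSeries.pderiv ℝ j A) (p + g + g) := by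
  set S₁ := ∑ j, g j * ev (MvPowerSeries.pderiv ℝ j A) (p + g)
  set S₂ := ∑ j, g j * ev (MvPowerSeries.pderiv ℝ j A) (p + g + g) with hS₂
  set R := ∑ j, g j * ∑ k, g k *
    ev (MvPowerSeries.pderiv ℝ k (MvPowerSeries.pderiv ℝ j A)) (p + g)
  have hS : S₁ + R ≤ S₂ := by
    simp only [S₁, R, ← Finset.sum_add_distrib, ← mul_add]
    exact Finset.sum_le_sum fun j _ =>
      mul_le_mul_right (ev_add_sum_pderiv_le (MvPowerSeries.pderiv ℝ j A) (p + g) g) _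
  simp only [Pi.add_apply g g, add_mul, Finset.sum_add_distrib, ← hS₂]
  calc ev A (p + g + g) + R
      ≤ ev A (p + g) + S₂ + R := by gcongr; exact ev_add_le A (p + g) g
    _ ≤ ev A p + S₁ + S₂ + R := by gcongr; exact ev_add_le A p g
    _ = ev A p + (S₁ + R + S₂) := by ring
    _ ≤ ev A p + (S₂ + S₂) := by gcongr

theorem mulVec_eq_of_le_mulVec_of_vecMul_eq {n : Type*} [Fintype n] {A : Matrix n n ENNReal}
    {u w : n → ENNReal} (hu0 : ∀ i, u i ≠ 0) (hu : ∀ i, u i ≠ ⊤) (huA : u ᵥ* A = u)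
    (hw : ∀ i, w i ≠ ⊤) (hle : w ≤ A *ᵥ w) : A *ᵥ w = w := by
  refine funext fun i => (hle i).antisymm' (not_lt.1 fun hlt => ?_)
  have hdot : u ⬝ᵥ w < u ⬝ᵥ (A *ᵥ w) := by
    classical
    simp only [dotProduct, ← Finset.add_sum_erase _ _ (Finset.mem_univ i)]
    refine ENNReal.add_lt_add_of_lt_of_le
      (ENNReal.sum_ne_top.2 fun j _ => ENNReal.mul_ne_top (hu j) (hw j)) ?_ ?_
    · exact (ENNReal.mul_lt_mul_iff_right (hu0 i) (hu i)).2 hlt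
    · exact Finset.sum_le_sum fun j _ => mul_le_mul_right (hle j) _
  rw [Matrix.dotProduct_mulVec, huA] at hdot
  exact hdot.false

variable {m : ℕ} {G : Fin m → MvPowerSeries (Fin (m + 1)) ℝ} {p q : Fin (m + 1) → ENNReal}

theorem tail_sub_add_le_jacobianENN_mulVec (hpq : p ≤ q) (h0 : p 0 = q 0) (hfin : ∀ k, p k ≠ ⊤)
    (hp : ∀ i, ev (G i) p = p i.succ) (hq : ∀ i, ev (G i) q = q i.succ) (i j k : Fin m) :
    Fin.tail (q - p) i + 2⁻¹ * (q - p) j.succ * (2⁻¹ * (q - p) k.succ *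
        ev (MvPowerSeries.pderiv ℝ k.succ (partialY G i j)) p) ≤
      (jacobianENN G q *ᵥ Fin.tail (q - p)) i := by
  set g := (2⁻¹ : ENNReal) • (q - p)
  have hg : g + g = q - p := by rw [← add_smul, ENNReal.inv_two_add_inv_two, one_smul]
  have hpg : p + g + g = q := by rw [add_assoc, hg, add_tsub_cancel_of_le hpq]
  have h0' : (q - p) 0 = 0 := by rw [Pi.sub_apply, h0, tsub_self]
  have hle := ev_add_add_le (G i) p g
  rw [hpg, hg, sum_mul_ev_pderiv_eq_add_mulVec, h0', zero_mul, zero_add, hp, hq,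
    ← add_tsub_cancel_of_le (hpq i.succ), add_assoc, ENNReal.add_le_add_iff_left (hfin _)] at hle
  refine (add_le_add_right ?_ _).trans hle
  calc g j.succ * (g k.succ * ev (MvPowerSeries.pderiv ℝ k.succ (partialY G i j)) p)
      ≤ g j.succ * (g k.succ * ev (MvPowerSeries.pderiv ℝ k.succ (partialY G i j)) (p + g)) := by
        gcongr
        exact ev_mono _ le_self_add
    _ ≤ g j.succ * ∑ k, g k * ev (MvPowerSeries.pderiv ℝ k (partialY G i j)) (p + g) :=
        mul_le_mul_right (Finset.single_le_sum_of_canonicallyOrdered (f := fun k =>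
          g k * ev (MvPowerSeries.pderiv ℝ k (partialY G i j)) (p + g)) (Finset.mem_univ k.succ)) _
    _ ≤ _ := Finset.single_le_sum_of_canonicallyOrdered (f := fun j => g j * ∑ k, g k *
          ev (MvPowerSeries.pderiv ℝ k (MvPowerSeries.pderiv ℝ j (G i))) (p + g))
          (Finset.mem_univ j.succ)

theorem eq_of_le_of_vecMul_eq (hG : IsWellConditioned G) (hpq : p ≤ q) (h0 : p 0 = q 0)
    (hp0 : ∀ k, p k ≠ 0) (hq_top : ∀ k, q k ≠ ⊤) (hp : ∀ i, ev (G i) p = p i.succ)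
    (hq : ∀ i, ev (G i) q = q i.succ) {u : Fin m → ENNReal} (hu0 : ∀ i, u i ≠ 0)
    (hu : ∀ i, u i ≠ ⊤) (huJ : u ᵥ* jacobianENN G q = u) : p = q := by
  have hp_top (k : Fin (m + 1)) : p k ≠ ⊤ := ne_top_of_le_ne_top (hq_top k) (hpq k)
  have hd_top (i : Fin m) : Fin.tail (q - p) i ≠ ⊤ := ENNReal.sub_ne_top (hq_top _)
  refine hpq.antisymm (Fin.cases h0.ge fun i₀ => not_lt.1 fun hlt => ?_)
  have hsub : jacobianENN G p *ᵥ Fin.tail (q - p) ≤ Fin.tail (q - p) := fun i =>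
    le_add_self.trans (add_jacobianENN_mulVec_sub_le hpq (hp i) (hq i) (hp_top _))
  have hd (k : Fin m) : (q - p) k.succ ≠ 0 := by
    obtain ⟨C, hC, hCle⟩ :=
      exists_mul_le_of_mulVec_le (hG.reflTransGen_jacobianENN_ne_zero hp0 k i₀)
    exact ne_bot_of_le_ne_bot (mul_ne_zero hC (tsub_pos_of_lt hlt).ne') (hCle _ hsub)
  have hconv := tail_sub_add_le_jacobianENN_mulVec hpq h0 hp_top hp hq
  have hfix : jacobianENN G q *ᵥ Fin.tail (q - p) = Fin.tail (q - p) :=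
    mulVec_eq_of_le_mulVec_of_vecMul_eq hu0 hu huJ hd_top fun i =>
      le_self_add.trans (hconv i i₀ i₀)
  obtain ⟨i, j, k, hijk⟩ := hG.nonlinear
  have hgap := hconv i j k
  rw [hfix] at hgap
  have hne : ev (MvPowerSeries.pderiv ℝ k.succ (partialY G i j)) p ≠ 0 :=
    ev_ne_zero (pderiv_mem_nonnegCoeff (partialY_mem_nonnegCoeff hG.nonneg i j) _) hijk hp0
  have h2 : (2⁻¹ : ENNReal) ≠ 0 := by simp
  exact hgap.not_gt (ENNReal.lt_add_right (hd_top i)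
    (mul_ne_zero (mul_ne_zero h2 (hd j)) (mul_ne_zero (mul_ne_zero h2 (hd k)) hne)))

end Eigenpoint

section Points

theorem map_ofReal_mulVec {n : Type*} [Fintype n] {A : Matrix n n ℝ} {v : n → ℝ}
    (hA : ∀ i j, 0 ≤ A i j) (hv : ∀ i, 0 ≤ v i) :
    A.map ENNReal.ofReal *ᵥ (ENNReal.ofReal ∘ v) = ENNReal.ofReal ∘ (A *ᵥ v) := funext fun i => by
  simp only [Function.comp_apply, Matrix.mulVec, dotProduct, Matrix.map_apply,
    ENNReal.ofReal_sum_of_nonneg fun j _ => mul_nonneg (hA i j) (hv j), ENNReal.ofReal_mul (hA i _)]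

theorem det_one_sub_eq_zero_of_hasEigenvalue_one {n : Type*} [Fintype n] [DecidableEq n]
    {A : Matrix n n ℝ} (hA : Module.End.HasEigenvalue (Matrix.toLin' A) 1) : (1 - A).det = 0 := by
  obtain ⟨z, hz⟩ := hA.exists_hasEigenvector
  refine Matrix.exists_mulVec_eq_zero_iff.1 ⟨z, hz.2, ?_⟩
  rw [Matrix.sub_mulVec, Matrix.one_mulVec, ← Matrix.toLin'_apply, hz.apply_eq_smul, one_smul,
    sub_self]

theorem exists_pos_add_smul_mem {E : Type*} [TopologicalSpace E] [AddCommGroup E] [Module ℝ E]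
    [ContinuousAdd E] [ContinuousSMul ℝ E] {S : Set E} {x : E} (hx : x ∈ interior S) (d : E) :
    ∃ s : ℝ, 0 < s ∧ x + s • d ∈ S := by
  have hcont : Continuous fun s : ℝ => x + s • d := by fun_prop
  have hev : ∀ᶠ s : ℝ in 𝓝 0, x + s • d ∈ S :=
    hcont.continuousAt.eventually_mem (by simpa using mem_interior_iff_mem_nhds.1 hx)
  exact ((eventually_mem_nhdsWithin (a := (0 : ℝ)) (s := Set.Ioi 0)).and
    (nhdsWithin_le_nhds hev)).exists

variable {m : ℕ} {G : Fin m → MvPowerSeries (Fin (m + 1)) ℝ} {T : Fin m → PowerSeries ℝ}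
  {p q : Fin (m + 1) → ℝ}

theorem jacobian_nonneg (G : Fin m → MvPowerSeries (Fin (m + 1)) ℝ) (p : Fin (m + 1) → ℝ)
    (i j : Fin m) : 0 ≤ jacobian G p i j :=
  ENNReal.toReal_nonneg

theorem jacobianENN_ofReal_comp (hp : ∀ k, 0 < p k) (hJ : JacobianFinite G p) :
    jacobianENN G (ENNReal.ofReal ∘ p) = (jacobian G p).map ENNReal.ofReal := by
  ext i j
  exact (evalNN_eq_ev _ fun k => (hp k).le).symm.trans (ENNReal.ofReal_toReal (hJ i j).ne).symm

theorem jacobianENN_mulVec_of_mulVec_eq (hp : ∀ k, 0 < p k) (hJ : JacobianFinite G p) {r : ℝ}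
    {v : Fin m → ℝ} (hv : ∀ i, 0 < v i) (hr : jacobian G p *ᵥ v = r • v) :
    jacobianENN G (ENNReal.ofReal ∘ p) *ᵥ (ENNReal.ofReal ∘ v) = ENNReal.ofReal ∘ (r • v) := by
  rw [jacobianENN_ofReal_comp hp hJ, map_ofReal_mulVec (jacobian_nonneg G p) fun i => (hv i).le, hr]

theorem vecMul_jacobianENN_of_vecMul_eq (hp : ∀ k, 0 < p k) (hJ : JacobianFinite G p)
    {u : Fin m → ℝ} (hu : ∀ i, 0 < u i) (huJ : u ᵥ* jacobian G p = u) :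
    (ENNReal.ofReal ∘ u) ᵥ* jacobianENN G (ENNReal.ofReal ∘ p) = ENNReal.ofReal ∘ u := by
  rw [← Matrix.mulVec_transpose] at huJ ⊢
  rw [jacobianENN_ofReal_comp hp hJ, ← Matrix.transpose_map,
    map_ofReal_mulVec (A := (jacobian G p)ᵀ) (fun i j => jacobian_nonneg G p j i)
      fun i => (hu i).le, huJ]

theorem IsWellConditioned.isIrreducible_jacobian (hG : IsWellConditioned G) (hp : ∀ k, 0 < p k)
    (hJ : JacobianFinite G p) : (jacobian G p).IsIrreducible := by
  have hne {k l : Fin m} (hkl : partialY G k l ≠ 0) : jacobian G p k l ≠ 0 := by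
    refine ENNReal.toReal_ne_zero.2 ⟨?_, (hJ k l).ne⟩
    rw [evalNN_eq_ev _ fun k => (hp k).le]
    exact ev_ne_zero (partialY_mem_nonnegCoeff hG.nonneg k l) hkl
      fun k => (ENNReal.ofReal_pos.2 (hp k)).ne'
  obtain ⟨i, j, k, hijk⟩ := hG.nonlinear
  refine isIrreducible_of_reflTransGen (jacobian_nonneg G p) ⟨i, j, hne fun h => hijk ?_⟩
    fun i j => (hG.irreducible i j).lift id fun _ _ => hne
  rw [h, map_zero]

theorem IsStandardSolution.radius_le_of_le_mulVec (hG : IsWellConditioned G)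
    (hT : IsStandardSolution G T) {x : ENNReal} (hx : x ≠ 0) {w : Fin m → ENNReal} (hw0 : w ≠ 0)
    (hw : ∀ i, w i ≠ ⊤) (hle : w ≤ jacobianENN G (curve T x) *ᵥ w) (i : Fin m) :
    radius (T i) ≤ x := by
  refine not_lt.1 fun hlt => hw0 ?_
  have hfin : ∀ k, curve T (radius (T i)) k ≠ ⊤ :=
    Fin.cases (hT.radius_ne_top hG i) fun j => hT.ev₁_radius_ne_top hG j i
  exact eq_zero_of_le_mulVec_of_mulVec_lt (hT.jacobianENN_mulVec_sub_lt hG hx hlt hfin)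
    (fun i => ENNReal.sub_ne_top (hfin i.succ)) hle hw

theorem exists_isExtremePoint (hG : IsWellConditioned G) : ∃ p, IsExtremePoint G p := by
  obtain ⟨T, hT⟩ := exists_isStandardSolution hG.nonneg hG.X_dvd
  obtain ⟨i₀⟩ := hG.nonempty
  refine ⟨ENNReal.toReal ∘ curve T (radius (T i₀)), T, hT, ENNReal.toReal_nonneg, fun i => ?_⟩
  have hρ : ENNReal.ofReal (curve T (radius (T i₀)) 0).toReal = radius (T i₀) :=
    ENNReal.ofReal_toReal (hT.radius_ne_top hG i₀)
  refine ⟨(hT.radius_eq_radius hG i i₀).trans hρ.symm, ?_⟩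
  refine (hasSum_iff_ev₁ (hT.mem_nonnegCoeff i) ENNReal.toReal_nonneg ENNReal.toReal_nonneg).2 ?_
  rw [hρ]
  exact (ENNReal.ofReal_toReal (hT.ev₁_radius_ne_top hG i i₀)).symm

namespace IsExtremePoint

theorem exists_curve_eq (h : IsExtremePoint G p) :
    ∃ T, IsStandardSolution G T ∧ (∀ i, radius (T i) = ENNReal.ofReal (p 0)) ∧
      curve T (ENNReal.ofReal (p 0)) = ENNReal.ofReal ∘ p := by
  obtain ⟨T, hT, h0, hp⟩ := h
  refine ⟨T, hT, fun i => (hp i).1, funext (Fin.cases rfl fun i => ?_)⟩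
  refine (hasSum_iff_ev₁ (hT.mem_nonnegCoeff i) h0 ?_).1 (hp i).2
  exact (hp i).2.nonneg fun n => mul_nonneg (hT.nonneg i n) (pow_nonneg h0 n)

theorem pos (hG : IsWellConditioned G) (h : IsExtremePoint G p) (k : Fin (m + 1)) : 0 < p k := by
  obtain ⟨T, hT, hrad, hcurve⟩ := h.exists_curve_eq
  obtain ⟨i₀⟩ := hG.nonempty
  have hk := hT.curve_ne_zero hG (hT.radius_ne_zero hG i₀) k
  rw [hrad, hcurve] at hk
  exact ENNReal.ofReal_pos.1 (pos_iff_ne_zero.2 hk)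

theorem unique (hG : IsWellConditioned G) (hp : IsExtremePoint G p) (hq : IsExtremePoint G q) :
    p = q := by
  obtain ⟨T, hT, hprad, hpcurve⟩ := hp.exists_curve_eq
  obtain ⟨S, hS, hqrad, hqcurve⟩ := hq.exists_curve_eq
  obtain rfl := hT.unique hG.X_dvd hS
  obtain ⟨i₀⟩ := hG.nonempty
  rw [← hprad i₀] at hpcurve
  rw [← hqrad i₀, hpcurve] at hqcurve
  exact funext fun k => (ENNReal.ofReal_eq_ofReal_iff (hp.pos hG k).le (hq.pos hG k).le).1
    (congrFun hqcurve k)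

theorem jacobianFinite (hG : IsWellConditioned G) (h : IsExtremePoint G p) :
    JacobianFinite G p := fun i j => by
  obtain ⟨T, hT, -, hcurve⟩ := h.exists_curve_eq
  rw [evalNN_eq_ev _ fun k => (h.pos hG k).le, ← hcurve, lt_top_iff_ne_top]
  exact hT.jacobianENN_curve_ne_top hG (ENNReal.ofReal_pos.2 (h.pos hG 0)).ne'
    (fun k => hcurve ▸ ENNReal.ofReal_ne_top) i j

theorem evalNN_eq (hG : IsWellConditioned G) (h : IsExtremePoint G p) (i : Fin m) :
    evalNN (G i) p = ENNReal.ofReal (p i.succ) := by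
  obtain ⟨T, hT, -, hcurve⟩ := h.exists_curve_eq
  rw [evalNN_eq_ev _ fun k => (h.pos hG k).le, ← hcurve, hT.ev_curve hG.nonneg, hcurve,
    Function.comp_apply]

theorem mem_posDomain (hG : IsWellConditioned G) (h : IsExtremePoint G p) : p ∈ posDomain G :=
  ⟨h.pos hG, fun i => (h.evalNN_eq hG i).trans_lt ENNReal.ofReal_lt_top⟩

theorem isEigenpoint_of_isLambda_one (hG : IsWellConditioned G) (h : IsExtremePoint G p)
    (hlam : IsLambda G p 1) : IsEigenpoint G p :=
  ⟨⟨h.pos hG, h.evalNN_eq hG, hlam.1, det_one_sub_eq_zero_of_hasEigenvalue_one hlam.2.1⟩, hlam⟩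

theorem le_one_of_mulVec_eq (hG : IsWellConditioned G) (h : IsExtremePoint G p) {r : ℝ}
    {v : Fin m → ℝ} (hv : ∀ i, 0 < v i) (hr : jacobian G p *ᵥ v = r • v) : r ≤ 1 := by
  obtain ⟨T, hT, -, hcurve⟩ := h.exists_curve_eq
  obtain ⟨i, hi⟩ := hT.exists_jacobianENN_mulVec_le hG (ENNReal.ofReal_pos.2 (h.pos hG 0)).ne'
    (fun k => hcurve ▸ ENNReal.ofReal_ne_top) (w := ENNReal.ofReal ∘ v)
    fun i => ENNReal.ofReal_ne_top
  rw [hcurve, jacobianENN_mulVec_of_mulVec_eq (h.pos hG) (h.jacobianFinite hG) hv hr] at hi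
  have hrv : r * v i ≤ v i := (ENNReal.ofReal_le_ofReal_iff (hv i).le).1 hi
  exact (mul_le_iff_le_one_left (hv i)).1 hrv

theorem one_le_of_mem_interior (hG : IsWellConditioned G) (h : IsExtremePoint G p)
    (hint : p ∈ interior (posDomain G)) {r : ℝ} {v : Fin m → ℝ} (hv : ∀ i, 0 < v i)
    (hr : jacobian G p *ᵥ v = r • v) : 1 ≤ r := by
  by_contra! hlt
  obtain ⟨T, hT, hrad, hcurve⟩ := h.exists_curve_eq
  set d : Fin (m + 1) → ℝ := Fin.cons 1 v
  have hd : ∀ k, 0 < d k := Fin.cases one_pos hv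
  obtain ⟨s, hspos, hs⟩ := exists_pos_add_smul_mem hint d
  have hsd (k : Fin (m + 1)) : 0 < (s • d) k := mul_pos hspos (hd k)
  have hsv : jacobian G p *ᵥ (s • v) = r • s • v := by rw [Matrix.mulVec_smul, hr, smul_comm]
  obtain ⟨y, hy, hyfin⟩ := hT.exists_gt_curve_ne_top hG (x := ENNReal.ofReal (p 0))
    (h := ENNReal.ofReal ∘ (s • d)) (fun k => hcurve ▸ ENNReal.ofReal_ne_top)
    (ENNReal.ofReal_pos.2 (hsd 0)).ne' (fun k => ENNReal.ofReal_ne_top)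
    (fun i => by
      have hadd : ENNReal.ofReal ∘ p + ENNReal.ofReal ∘ (s • d) = ENNReal.ofReal ∘ (p + s • d) :=
        funext fun k => (ENNReal.ofReal_add (h.pos hG k).le (hsd k).le).symm
      rw [hcurve, hadd, ← evalNN_eq_ev _ fun k => (hs.1 k).le]
      exact (hs.2 i).ne)
    (fun i => by
      rw [hcurve]
      refine (congrFun (jacobianENN_mulVec_of_mulVec_eq (h.pos hG) (h.jacobianFinite hG)
        (fun i => hsd i.succ) hsv) i).trans_lt ((ENNReal.ofReal_lt_ofReal_iff (hsd i.succ)).2 ?_)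
      exact mul_lt_of_lt_one_left (hsd i.succ) hlt)
  obtain ⟨i₀⟩ := hG.nonempty
  exact hy.not_ge
    (hrad i₀ ▸ le_radius_of_ev₁_ne_top (hT.mem_nonnegCoeff i₀) (hyfin 0) (hyfin i₀.succ))

end IsExtremePoint

namespace IsEigenpoint

theorem exists_fixed_vectors (hG : IsWellConditioned G) (h : IsEigenpoint G q) :
    ∃ v u : Fin m → ℝ, (∀ i, 0 < v i) ∧ (∀ i, 0 < u i) ∧
      jacobian G q *ᵥ v = v ∧ u ᵥ* jacobian G q = u := by
  have := hG.nonempty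
  obtain ⟨r, v, u, hv, hu, hrv, hru, hr⟩ :=
    exists_perron_root (hG.isIrreducible_jacobian h.1.pos h.1.jacobianFinite)
  obtain rfl := hr.unique h.2.2
  exact ⟨v, u, hv, hu, by rwa [one_smul] at hrv, by rwa [one_smul] at hru⟩

theorem curve_eq (hG : IsWellConditioned G) (h : IsEigenpoint G q) (hT : IsStandardSolution G T) :
    curve T (ENNReal.ofReal (q 0)) = ENNReal.ofReal ∘ q := by
  obtain ⟨-, u, -, hu, -, hJu⟩ := h.exists_fixed_vectors hG
  have hev (i : Fin m) : ev (G i) (ENNReal.ofReal ∘ q) = ENNReal.ofReal (q i.succ) :=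
    (evalNN_eq_ev _ fun k => (h.1.pos k).le).symm.trans (h.1.solution i)
  have hle : curve T (ENNReal.ofReal (q 0)) ≤ ENNReal.ofReal ∘ q :=
    hT.curve_le_of_supersolution hG.nonneg hG.X_dvd (P := ENNReal.ofReal ∘ q) fun i => (hev i).le
  exact eq_of_le_of_vecMul_eq hG hle rfl
    (hT.curve_ne_zero hG (ENNReal.ofReal_pos.2 (h.1.pos 0)).ne') (fun k => ENNReal.ofReal_ne_top)
    (hT.ev_curve hG.nonneg _) hev (fun i => (ENNReal.ofReal_pos.2 (hu i)).ne')
    (fun i => ENNReal.ofReal_ne_top)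
    (vecMul_jacobianENN_of_vecMul_eq h.1.pos h.1.jacobianFinite hu hJu)

theorem radius_eq (hG : IsWellConditioned G) (h : IsEigenpoint G q) (hT : IsStandardSolution G T)
    (i : Fin m) : radius (T i) = ENNReal.ofReal (q 0) := by
  have hcurve := h.curve_eq hG hT
  obtain ⟨v, -, hv, -, hJv, -⟩ := h.exists_fixed_vectors hG
  refine le_antisymm ?_ ?_
  · refine hT.radius_le_of_le_mulVec hG (ENNReal.ofReal_pos.2 (h.1.pos 0)).ne'
      (w := ENNReal.ofReal ∘ v) (fun h0 => (ENNReal.ofReal_pos.2 (hv i)).ne' (congrFun h0 i))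
      (fun i => ENNReal.ofReal_ne_top) (ge_of_eq ?_) i
    rw [hcurve, jacobianENN_mulVec_of_mulVec_eq h.1.pos h.1.jacobianFinite hv
      (hJv.trans (one_smul ℝ v).symm), one_smul]
  · exact le_radius_of_ev₁_ne_top (hT.mem_nonnegCoeff i) ENNReal.ofReal_ne_top
      ((congrFun hcurve i.succ).trans_ne ENNReal.ofReal_ne_top)

theorem eq_of_isExtremePoint (hG : IsWellConditioned G) (hq : IsEigenpoint G q)
    (hp : IsExtremePoint G p) : q = p := by
  obtain ⟨T, hT, hrad, hcurve⟩ := hp.exists_curve_eq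
  obtain ⟨i₀⟩ := hG.nonempty
  have hqcurve := hq.curve_eq hG hT
  rw [← hq.radius_eq hG hT i₀, hrad, hcurve] at hqcurve
  exact funext fun k => ((ENNReal.ofReal_eq_ofReal_iff (hp.pos hG k).le (hq.1.pos k).le).1
    (congrFun hqcurve k)).symm

end IsEigenpoint

end Points

end RecursiveSystem

end

theorem mainTheorem1 {m : ℕ} (G : Fin m → MvPowerSeries (Fin (m + 1)) ℝ)
    (hG : RecursiveSystem.IsWellConditioned G) :
    (∃! p : Fin (m + 1) → ℝ, RecursiveSystem.IsExtremePoint G p) ∧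
    ∀ p : Fin (m + 1) → ℝ, RecursiveSystem.IsExtremePoint G p →
      p ∈ RecursiveSystem.posDomain G ∧
      (p ∈ interior (RecursiveSystem.posDomain G) → RecursiveSystem.IsEigenpoint G p) ∧
      {q | RecursiveSystem.IsEigenpoint G q}.Subsingleton ∧
      (∀ q, RecursiveSystem.IsEigenpoint G q → q = p) ∧
      ((¬ ∃ q, RecursiveSystem.IsEigenpoint G q) →
        p ∈ frontier (RecursiveSystem.posDomain G) ∧
          ∃ l : ℝ, RecursiveSystem.IsLambda G p l ∧ l < 1) := by
  obtain ⟨p₀, hp₀⟩ := RecursiveSystem.exists_isExtremePoint hG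
  refine ⟨⟨p₀, hp₀, fun q hq => hq.unique hG hp₀⟩, fun p hp => ?_⟩
  have hdom := hp.mem_posDomain hG
  have hJ := hp.jacobianFinite hG
  have := hG.nonempty
  obtain ⟨r, v, u, hv, -, hrv, -, hr⟩ :=
    RecursiveSystem.exists_perron_root (hG.isIrreducible_jacobian hdom.1 hJ)
  have hr_le := hp.le_one_of_mulVec_eq hG hv hrv
  have eigenpoint_of_eq (h : r = 1) : RecursiveSystem.IsEigenpoint G p :=
    hp.isEigenpoint_of_isLambda_one hG (h ▸ ⟨hJ, hr⟩)
  have eigenpoint_of_interior (h : p ∈ interior (RecursiveSystem.posDomain G)) :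
      RecursiveSystem.IsEigenpoint G p :=
    eigenpoint_of_eq (le_antisymm hr_le (hp.one_le_of_mem_interior hG h hv hrv))
  have eq_extremePoint (q) (hq : RecursiveSystem.IsEigenpoint G q) : q = p :=
    hq.eq_of_isExtremePoint hG hp
  refine ⟨hdom, eigenpoint_of_interior,
    fun q hq q' hq' => (eq_extremePoint q hq).trans (eq_extremePoint q' hq').symm,
    eq_extremePoint, fun hno => ?_⟩
  exact ⟨⟨subset_closure hdom, fun h => hno ⟨p, eigenpoint_of_interior h⟩⟩,
    r, ⟨hJ, hr⟩, hr_le.lt_of_ne fun h => hno ⟨p, eigenpoint_of_eq h⟩⟩
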